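/- An instance of \textsc{PAV-MW} consists of a finite set $\mathcal A$ of $m$ alternatives, a finite set $\mathcal V=\{v_1,\dots,v_n\}$ of voters, an approval set $V_i\subseteq\mathcal A$ for each voter $v_i$, a committee size $k\in\mathbb N$, and a rational score bound $S\ge 0$ (given as a fraction in binary). The question is whether there is a set $W\subseteq\mathcal A$ with $|W|=k$ and $$\sum_{i=1}^{n} h(|V_i\cap W|)\ \ge\ S,\qquad\text{where } h(x)=\sum_{j=1}^{x}\frac1j .$$ Let $b=\max_i|V_i|$ (with $b=0$ if $n=0$). **Theorem.** \textsc{PAV-MW} admits a kernel of exponential size for the combined parameter $(b,S)$: there are a polynomial $q$ and a polynomial-time algorithm that transforms every instance $I$ of \textsc{PAV-MW}, with parameters $b$ and $S$, into an instance $I'$ of \textsc{PAV-MW}, with parameters $b'$ and $S'$, such that 1. $I'$ is a yes-instance if and only if $I$ is a yes-instance; and 2. the encoding size of $I'$ and the number $b'+\lceil S'\rceil$ are both at most $2^{q(b+\lceil S\rceil)}$. -/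

import Mathlib

/-! ### Random access machines with a step count

A structured random access machine over the natural numbers. A machine has finitely many
registers and arrays (those that its program mentions), and a write-only output tape. Its only
arithmetic operations are addition and truncated subtraction, at unit cost, so that each operation
increases the maximal bit length of the numbers in use by at most one: up to a polynomial, the step
count is the running time of a Turing machine. -/

namespace RAM

/-- Expressions: constants, registers, array cells, sums and truncated differences. -/
inductive Expr : Type
  | const (c : ℕ) : Expr
  | reg (x : ℕ) : Expr
  | cell (a : ℕ) (i : Expr) : Expr
  | add (e₁ e₂ : Expr) : Expr
  | sub (e₁ e₂ : Expr) : Expr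

/-- Programs. A test `e` succeeds if the value of `e` is not zero. -/
inductive Program : Type
  | skip : Program
  | assign (x : ℕ) (e : Expr) : Program
  | store (a : ℕ) (i e : Expr) : Program
  | emit (e : Expr) : Program
  | seq (P Q : Program) : Program
  | ite (e : Expr) (P Q : Program) : Program
  | while (e : Expr) (P : Program) : Program

/-- The memory: the register contents, the array contents, and what has been written to the output
tape. -/
structure State : Type where
  reg : ℕ → ℕ
  arr : ℕ → ℕ → ℕ
  out : List ℕ

/-- The value of an expression. -/
def Expr.eval (s : State) : Expr → ℕ
  | .const c => c
  | .reg x => s.reg x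
  | .cell a i => s.arr a (i.eval s)
  | .add e₁ e₂ => e₁.eval s + e₂.eval s
  | .sub e₁ e₂ => e₁.eval s - e₂.eval s

/-- The number of steps that the evaluation of an expression takes. -/
def Expr.cost : Expr → ℕ
  | .const _ => 1
  | .reg _ => 1
  | .cell _ i => i.cost + 1
  | .add e₁ e₂ => e₁.cost + e₂.cost + 1
  | .sub e₁ e₂ => e₁.cost + e₂.cost + 1

/-- Write the value `v` to register `x`. -/
def State.setReg (s : State) (x v : ℕ) : State :=
  { s with reg := Function.update s.reg x v }

/-- Write the value `v` to the cell `i` of the array `a`. -/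
def State.setCell (s : State) (a i v : ℕ) : State :=
  { s with arr := Function.update s.arr a (Function.update (s.arr a) i v) }

/-- Append the value `v` to the output tape. -/
def State.write (s : State) (v : ℕ) : State :=
  { s with out := s.out ++ [v] }

/-- `Exec P s t s'`: started in the state `s`, the program `P` halts after exactly `t` steps, in
the state `s'`. -/
inductive Exec : Program → State → ℕ → State → Prop
  | skip (s : State) : Exec .skip s 1 s
  | assign (s : State) (x : ℕ) (e : Expr) :
      Exec (.assign x e) s (e.cost + 1) (s.setReg x (e.eval s))
  | store (s : State) (a : ℕ) (i e : Expr) :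
      Exec (.store a i e) s (i.cost + e.cost + 1) (s.setCell a (i.eval s) (e.eval s))
  | emit (s : State) (e : Expr) :
      Exec (.emit e) s (e.cost + 1) (s.write (e.eval s))
  | seq {P Q : Program} {s s' s'' : State} {t t' : ℕ} :
      Exec P s t s' → Exec Q s' t' s'' → Exec (.seq P Q) s (t + t') s''
  | ite_true {e : Expr} {P Q : Program} {s s' : State} {t : ℕ} :
      e.eval s ≠ 0 → Exec P s t s' → Exec (.ite e P Q) s (e.cost + 1 + t) s'
  | ite_false {e : Expr} {P Q : Program} {s s' : State} {t : ℕ} :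
      e.eval s = 0 → Exec Q s t s' → Exec (.ite e P Q) s (e.cost + 1 + t) s'
  | while_true {e : Expr} {P : Program} {s s' s'' : State} {t t' : ℕ} :
      e.eval s ≠ 0 → Exec P s t s' → Exec (.while e P) s' t' s'' →
      Exec (.while e P) s (e.cost + 1 + t + t') s''
  | while_false {e : Expr} {P : Program} {s : State} :
      e.eval s = 0 → Exec (.while e P) s (e.cost + 1) s

/-- The initial state on the input word `w`: array `0` holds the input, register `0` its length,
everything else is zero, and the output tape is empty. -/
def initial (w : List ℕ) : State where
  reg := fun x => if x = 0 then w.length else 0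
  arr := fun a i => if a = 0 then w.getD i 0 else 0
  out := []

/-- The size of a word of natural numbers: the total number of binary digits, plus one separator
for each entry. -/
def wordSize (w : List ℕ) : ℕ := (w.map fun x => Nat.size x + 1).sum

/-- `f` is computable in polynomial time, inputs and outputs being encoded by `enc`: some program
maps, on every `x`, the word `enc x` to the word `enc (f x)`, in a number of steps that is at most
a fixed polynomial in the size of `enc x`. -/
def PolyTimeComputable {α : Type} (enc : α → List ℕ) (f : α → α) : Prop :=
  ∃ (P : Program) (p : Polynomial ℕ), ∀ x : α, ∃ (t : ℕ) (s : State),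
    Exec P (initial (enc x)) t s ∧ s.out = enc (f x) ∧ t ≤ p.eval (wordSize (enc x))

end RAM

/-! ### Kernelization -/

/-- The decision problem with instances `α` (encoded by `enc`), yes-instances `yes` and parameter
`κ` admits a kernel of size `g`: a polynomial-time algorithm transforms each instance `x` into an
equivalent instance of the same problem whose size and whose parameter are at most `g (κ x)`. -/
def AdmitsKernelOfSize {α : Type} (enc : α → List ℕ) (yes : α → Prop) (κ : α → ℕ)
    (g : ℕ → ℕ) : Prop :=
  ∃ f : α → α, RAM.PolyTimeComputable enc f ∧
    ∀ x : α, (yes (f x) ↔ yes x) ∧ RAM.wordSize (enc (f x)) ≤ g (κ x) ∧ κ (f x) ≤ g (κ x)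

/-! ### Multi-winner determination under proportional approval voting -/

/-- An instance: an approval preference profile with alternatives `0, …, m - 1` and voters
`0, …, n - 1`, where `approval i` is the approval set of voter `i`; a committee size `k`; and a
score bound, a nonnegative rational number that is given as a (not necessarily reduced)
fraction. -/
structure PAVInstance : Type where
  m : ℕ
  n : ℕ
  approval : Fin n → Finset (Fin m)
  k : ℕ
  scoreNum : ℕ
  scoreDen : ℕ
  scoreDen_pos : 0 < scoreDen

namespace PAVInstance

/-- The score bound `S`. -/
def S (I : PAVInstance) : ℚ := (I.scoreNum : ℚ) / (I.scoreDen : ℚ)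

/-- The PAV score of a committee `W`: each voter `i` contributes `1 + 1/2 + ⋯ + 1/x`, where `x` is
the number of members of `W` that `i` approves of. -/
def score (I : PAVInstance) (W : Finset (Fin I.m)) : ℚ :=
  ∑ i : Fin I.n, harmonic (I.approval i ∩ W).card

/-- The question: is there a committee of size `k` whose PAV score is at least `S`? -/
def IsYes (I : PAVInstance) : Prop :=
  ∃ W : Finset (Fin I.m), W.card = I.k ∧ I.S ≤ I.score W

/-- The maximum size `b` of an approval set (zero if there are no voters). -/
def b (I : PAVInstance) : ℕ := Finset.univ.sup fun i : Fin I.n => (I.approval i).card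

/-- The combined parameter `(b, S)`, as the natural number `b + ⌈S⌉`. -/
def param (I : PAVInstance) : ℕ := I.b + ⌈I.S⌉₊

/-- The encoding as a word: the numbers `m, n, k` and the fraction `S`, the list of the
alternatives, and then, for each voter, its name followed by the 0/1 characteristic vector of its
approval set. -/
def encode (I : PAVInstance) : List ℕ :=
  [I.m, I.n, I.k, I.scoreNum, I.scoreDen] ++ List.range I.m ++
    (List.finRange I.n).flatMap fun i : Fin I.n =>
      i.val :: (List.finRange I.m).map fun a : Fin I.m => if a ∈ I.approval i then 1 else 0

end PAVInstance

/-!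
The kernelization rests on two observations about an instance with parameters `b` and `s = ⌈S⌉` in
which no trivial answer applies; in particular, every alternative has fewer than `s` approvals,
since a committee that contains an alternative with `s` approvals already scores `S`.

First, a committee of score at least `S` contains a committee of at most `s * (b + 1)` members whose
score is still at least `S` (`exists_small_subset`). Secondly, let `R` be the set of the
`4 ^ (b + s)` alternatives with the most approvals. If a member `a` of a small committee does not
belong to `R`, then some `d ∈ R` shares no voter with the other members, as these share voters with
few alternatives only. Such a `d` contributes all its approvals, so it can replace `a`
(`exists_subset_pavScore_ge`). Hence only the alternatives in `R`, the at most `s * |R|` voters who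
approve of some of them, and the committee size `min k |R|` matter (`exists_committee_iff`). The
numbers in the score bound are made small by rounding it up to a multiple of `1 / b!`, which does not
change the question, since all scores are such multiples (`PAVInstance.restrict_S_le_iff`).

The machine program is written in a language whose loops are all bounded by registers that never
change (`RAM.Stmt`). A program in this language runs in polynomial time for syntactic reasons
(`RAM.Stmt.exists_exec`), and its result is given by a function on states (`RAM.Stmt.run`), about
which one reasons with loop invariants. All loops of the kernelization run over the alternatives or
over the voters. The multiplications and divisions that the machine lacks are interleaved:
`⌈S⌉` is found by adding up the denominator of `S`, and then `⌈S * j!⌉` is computed for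
`j = 1, …, b` along with its rounding error (`PAVInstance.round_run`).
-/

/-! ### A structured language with bounded loops -/

namespace RAM

-- Expressions are written in the usual notation for sums, truncated differences and numerals.
instance : Add Expr := ⟨Expr.add⟩
instance : Sub Expr := ⟨Expr.sub⟩
instance (c : ℕ) : OfNat Expr c := ⟨Expr.const c⟩

section Eval
variable (s : State)

@[simp] theorem Expr.eval_add (e f : Expr) : (e + f).eval s = e.eval s + f.eval s := rfl
@[simp] theorem Expr.eval_sub (e f : Expr) : (e - f).eval s = e.eval s - f.eval s := rfl
@[simp] theorem Expr.eval_ofNat (c : ℕ) [c.AtLeastTwo] :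
    (ofNat(c) : Expr).eval s = c := rfl
@[simp] theorem Expr.eval_zero : (0 : Expr).eval s = 0 := rfl
@[simp] theorem Expr.eval_one : (1 : Expr).eval s = 1 := rfl
@[simp] theorem Expr.eval_reg (x : ℕ) : (Expr.reg x).eval s = s.reg x := rfl
@[simp] theorem Expr.eval_cell (a : ℕ) (i : Expr) :
    (Expr.cell a i).eval s = s.arr a (i.eval s) := rfl

@[simp] theorem State.setReg_reg (x v y : ℕ) :
    (s.setReg x v).reg y = if y = x then v else s.reg y := by
  simp [State.setReg, Function.update_apply]
@[simp] theorem State.setReg_arr (x v : ℕ) : (s.setReg x v).arr = s.arr := rfl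
@[simp] theorem State.setReg_out (x v : ℕ) : (s.setReg x v).out = s.out := rfl
@[simp] theorem State.setCell_reg (a i v : ℕ) : (s.setCell a i v).reg = s.reg := rfl
@[simp] theorem State.setCell_arr (a i v a' j : ℕ) :
    (s.setCell a i v).arr a' j = if a' = a ∧ j = i then v else s.arr a' j := by
  by_cases ha : a' = a
  · subst ha; simp [State.setCell, Function.update_apply]
  · simp [State.setCell, ha]
@[simp] theorem State.setCell_out (a i v : ℕ) : (s.setCell a i v).out = s.out := rfl
@[simp] theorem State.write_reg (v : ℕ) : (s.write v).reg = s.reg := rfl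
@[simp] theorem State.write_arr (v : ℕ) : (s.write v).arr = s.arr := rfl
@[simp] theorem State.write_out (v : ℕ) : (s.write v).out = s.out ++ [v] := rfl

end Eval

/-- Programs in which every repetition is a counting loop: `loop x b P` runs `P` with the counter
`x` going through `0, …, b - 1`, where `x` and `b` are registers. -/
inductive Stmt : Type
  | skip : Stmt
  | assign (x : ℕ) (e : Expr) : Stmt
  | store (a : ℕ) (i e : Expr) : Stmt
  | emit (e : Expr) : Stmt
  | seq (P Q : Stmt) : Stmt
  | ite (e : Expr) (P Q : Stmt) : Stmt
  | loop (x b : ℕ) (P : Stmt) : Stmt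

infixr:60 " ;; " => Stmt.seq

namespace Stmt

/-- The translation into machine programs. -/
def toProgram : Stmt → Program
  | skip => .skip
  | assign x e => .assign x e
  | store a i e => .store a i e
  | emit e => .emit e
  | seq P Q => .seq P.toProgram Q.toProgram
  | ite e P Q => .ite e P.toProgram Q.toProgram
  | loop x b P => .seq (.assign x 0)
      (.while (.reg b - .reg x) (.seq P.toProgram (.assign x (.reg x + 1))))

/-- The state in which a program halts. It describes the translated program only if the program is
well-formed, since the number of repetitions of a loop is read off before the loop is entered. -/
def run : Stmt → State → State
  | skip, s => s
  | assign x e, s => s.setReg x (e.eval s)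
  | store a i e, s => s.setCell a (i.eval s) (e.eval s)
  | emit e, s => s.write (e.eval s)
  | seq P Q, s => Q.run (P.run s)
  | ite e P Q, s => if e.eval s = 0 then Q.run s else P.run s
  | loop x b P, s =>
      (fun s' => (P.run s').setReg x ((P.run s').reg x + 1))^[s.reg b] (s.setReg x 0)

section
variable (s : State)
@[simp] theorem run_skip : skip.run s = s := rfl
@[simp] theorem run_assign (x : ℕ) (e : Expr) : (assign x e).run s = s.setReg x (e.eval s) := rfl
@[simp] theorem run_store (a : ℕ) (i e : Expr) :
    (store a i e).run s = s.setCell a (i.eval s) (e.eval s) := rfl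
@[simp] theorem run_emit (e : Expr) : (emit e).run s = s.write (e.eval s) := rfl
@[simp] theorem run_seq (P Q : Stmt) : (P ;; Q).run s = Q.run (P.run s) := rfl
@[simp] theorem run_ite (e : Expr) (P Q : Stmt) :
    (ite e P Q).run s = if e.eval s = 0 then Q.run s else P.run s := rfl
end

/-- The registers that a program may change. -/
def regs : Stmt → List ℕ
  | skip | store _ _ _ | emit _ => []
  | assign x _ => [x]
  | seq P Q | ite _ P Q => P.regs ++ Q.regs
  | loop x _ P => x :: P.regs

/-- The arrays that a program may change. -/
def arrs : Stmt → List ℕ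
  | skip | assign _ _ | emit _ => []
  | store a _ _ => [a]
  | seq P Q | ite _ P Q => P.arrs ++ Q.arrs
  | loop _ _ P => P.arrs

/-- Whether a program contains an output instruction. -/
def emits : Stmt → Bool
  | skip | assign _ _ | store _ _ _ => false
  | emit _ => true
  | seq P Q | ite _ P Q => P.emits || Q.emits
  | loop _ _ P => P.emits

/-- Well-formedness relative to a list `C` of registers: the registers in `C` are never changed,
every loop is bounded by a register in `C`, and no loop body changes its own counter. -/
def WF (C : List ℕ) : Stmt → Bool
  | skip | store _ _ _ | emit _ => true
  | assign x _ => x ∉ C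
  | seq P Q | ite _ P Q => P.WF C && Q.WF C
  | loop x b P => b ∈ C && x ∉ C && x ∉ P.regs && P.WF C

/-- A bound on the number of steps of a well-formed program, as a polynomial in the largest loop
bound. Entering and leaving a loop takes six steps; in each iteration, the test and the increment
take eight steps in addition to those of the body. -/
noncomputable def time : Stmt → Polynomial ℕ
  | skip => 1
  | assign _ e => (e.cost + 1 : ℕ)
  | store _ i e => (i.cost + e.cost + 1 : ℕ)
  | emit e => (e.cost + 1 : ℕ)
  | seq P Q => P.time + Q.time
  | ite e P Q => (e.cost + 1 : ℕ) + P.time + Q.time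
  | loop _ _ P => 2 + .X * (P.time + 8) + 4

theorem run_reg {r : ℕ} : ∀ {P : Stmt} (s : State), r ∉ P.regs → (P.run s).reg r = s.reg r
  | skip, _, _ | store _ _ _, _, _ | emit _, _, _ => rfl
  | assign x e, s, h => by simp_all [regs]
  | seq P Q, s, h => by
    simp only [regs, List.mem_append, not_or] at h
    rw [run_seq, run_reg _ h.2, run_reg _ h.1]
  | ite e P Q, s, h => by
    simp only [regs, List.mem_append, not_or] at h
    rw [run_ite]
    split_ifs
    exacts [run_reg _ h.2, run_reg _ h.1]
  | loop x b P, s, h => by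
    simp only [regs, List.mem_cons, not_or] at h
    rw [run]
    generalize s.reg b = n
    induction n with
    | zero => simp [h.1]
    | succ n ih => rw [Function.iterate_succ_apply', State.setReg_reg, if_neg h.1, run_reg _ h.2, ih]

theorem run_arr {a : ℕ} : ∀ {P : Stmt} (s : State), a ∉ P.arrs → (P.run s).arr a = s.arr a
  | skip, _, _ | assign _ _, _, _ | emit _, _, _ => rfl
  | store x i e, s, h => by
    simp only [arrs, List.mem_singleton] at h
    funext j
    simp [h]
  | seq P Q, s, h => by
    simp only [arrs, List.mem_append, not_or] at h
    rw [run_seq, run_arr _ h.2, run_arr _ h.1]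
  | ite e P Q, s, h => by
    simp only [arrs, List.mem_append, not_or] at h
    rw [run_ite]
    split_ifs
    exacts [run_arr _ h.2, run_arr _ h.1]
  | loop x b P, s, h => by
    simp only [arrs] at h
    rw [run]
    generalize s.reg b = n
    induction n with
    | zero => simp
    | succ n ih => rw [Function.iterate_succ_apply', State.setReg_arr, run_arr _ h, ih]

theorem run_out : ∀ {P : Stmt} (s : State), P.emits = false → (P.run s).out = s.out
  | skip, _, _ | assign _ _, _, _ | store _ _ _, _, _ => rfl
  | seq P Q, s, h => by
    simp only [emits, Bool.or_eq_false_iff] at h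
    rw [run_seq, run_out _ h.2, run_out _ h.1]
  | ite e P Q, s, h => by
    simp only [emits, Bool.or_eq_false_iff] at h
    rw [run_ite]
    split_ifs
    exacts [run_out _ h.2, run_out _ h.1]
  | loop x b P, s, h => by
    simp only [emits] at h
    rw [run]
    generalize s.reg b = n
    induction n with
    | zero => simp
    | succ n ih => rw [Function.iterate_succ_apply', State.setReg_out, run_out _ h, ih]

theorem not_mem_regs_of_WF {C : List ℕ} {r : ℕ} (hr : r ∈ C) : ∀ {P : Stmt}, P.WF C → r ∉ P.regs
  | skip, _ | store _ _ _, _ | emit _, _ => by simp [regs]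
  | assign x e, h => by
    simp only [WF, decide_eq_true_eq] at h
    simp only [regs, List.mem_singleton]
    rintro rfl
    exact h hr
  | seq P Q, h | ite _ P Q, h => by
    simp only [WF, Bool.and_eq_true] at h
    simp [regs, not_mem_regs_of_WF hr h.1, not_mem_regs_of_WF hr h.2]
  | loop x b P, h => by
    simp only [WF, Bool.and_eq_true, decide_eq_true_eq] at h
    simp only [regs, List.mem_cons, not_or]
    exact ⟨fun e => h.1.1.2 (e ▸ hr), not_mem_regs_of_WF hr h.2⟩

/-- A well-formed program halts in the state that `run` computes, within polynomial time. -/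
theorem exists_exec {C : List ℕ} {N : ℕ} : ∀ (P : Stmt) (s : State), P.WF C →
    (∀ c ∈ C, s.reg c ≤ N) → ∃ t ≤ P.time.eval N, Exec P.toProgram s t (P.run s)
  | skip, s, _, _ => ⟨1, by simp [time], .skip s⟩
  | assign x e, s, _, _ => ⟨_, by simp [time], .assign s x e⟩
  | store a i e, s, _, _ => ⟨_, by simp [time], .store s a i e⟩
  | emit e, s, _, _ => ⟨_, by simp [time], .emit s e⟩
  | seq P Q, s, h, hC => by
    simp only [WF, Bool.and_eq_true] at h
    obtain ⟨t, ht, hP⟩ := exists_exec P s h.1 hC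
    obtain ⟨t', ht', hQ⟩ := exists_exec (N := N) Q (P.run s) h.2 fun c hc => by
      rw [run_reg _ (not_mem_regs_of_WF hc h.1)]; exact hC c hc
    exact ⟨t + t', by simp only [time, Polynomial.eval_add]; omega, .seq hP hQ⟩
  | ite e P Q, s, h, hC => by
    simp only [WF, Bool.and_eq_true] at h
    by_cases he : e.eval s = 0
    · obtain ⟨t, ht, hQ⟩ := exists_exec Q s h.2 hC
      refine ⟨e.cost + 1 + t, ?_, ?_⟩
      · simp only [time, Polynomial.eval_add, Polynomial.eval_natCast]; simp; omega
      · rw [run_ite, if_pos he]; exact .ite_false he hQ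
    · obtain ⟨t, ht, hP⟩ := exists_exec P s h.1 hC
      refine ⟨e.cost + 1 + t, ?_, ?_⟩
      · simp only [time, Polynomial.eval_add, Polynomial.eval_natCast]; simp; omega
      · rw [run_ite, if_neg he]; exact .ite_true he hP
  | loop x b P, s, h, hC => by
    simp only [WF, Bool.and_eq_true, decide_eq_true_eq] at h
    obtain ⟨⟨⟨hb, hx⟩, hxP⟩, hP⟩ := h
    have hbx : b ≠ x := fun e => hx (e ▸ hb)
    have key : ∀ (k : ℕ) (s : State), s.reg b = s.reg x + k → (∀ c ∈ C, s.reg c ≤ N) →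
        ∃ t ≤ k * (P.time.eval N + 8) + 4,
          Exec (.while (.reg b - .reg x) (.seq P.toProgram (.assign x (.reg x + 1)))) s t
            ((fun s' => (P.run s').setReg x ((P.run s').reg x + 1))^[k] s) := by
      intro k
      induction k with
      | zero =>
        intro s hs _
        exact ⟨4, by simp, .while_false (by simp [hs])⟩
      | succ k ih =>
        intro s hs hC
        obtain ⟨t, ht, h1⟩ := exists_exec P s hP hC
        have hsx : (P.run s).reg x = s.reg x := run_reg _ hxP
        have hsb : (P.run s).reg b = s.reg b := run_reg _ (not_mem_regs_of_WF hb hP)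
        obtain ⟨t', ht', h2⟩ := ih ((P.run s).setReg x ((P.run s).reg x + 1))
          (by simp only [State.setReg_reg, if_neg hbx, if_true, hsx, hsb, hs]; omega)
          (fun c hc => by
            rw [State.setReg_reg, if_neg (ne_of_mem_of_not_mem hc hx),
              run_reg _ (not_mem_regs_of_WF hc hP)]
            exact hC c hc)
        refine ⟨4 + (t + 4) + t', ?_, ?_⟩
        · rw [Nat.succ_mul]; omega
        · exact .while_true (by simp [hs]) (.seq h1 (.assign _ _ _)) h2
    obtain ⟨t, ht, h1⟩ := key (s.reg b) (s.setReg x 0) (by simp [hbx]) fun c hc => by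
      rw [State.setReg_reg, if_neg (ne_of_mem_of_not_mem hc hx)]; exact hC c hc
    refine ⟨2 + t, ?_, .seq (.assign s x 0) h1⟩
    have := Nat.mul_le_mul_right (P.time.eval N + 8) (hC b hb)
    simp [time]
    omega

/-- The invariant rule for loops. The facts that the invariant need not repeat are supplied to the
induction step: the value of the counter, and that whatever the body cannot change still has its
initial value. -/
theorem loop_induction {x b : ℕ} {P : Stmt} {s : State} (inv : ℕ → State → Prop)
    (hx : x ∉ P.regs) (h0 : inv 0 (s.setReg x 0))
    (hstep : ∀ i < s.reg b, ∀ s', s'.reg x = i → (∀ r ∉ P.regs, r ≠ x → s'.reg r = s.reg r) →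
      (∀ a ∉ P.arrs, s'.arr a = s.arr a) → inv i s' → inv (i + 1) ((P.run s').setReg x (i + 1))) :
    inv (s.reg b) ((loop x b P).run s) := by
  rw [run]
  set F := fun s' => (P.run s').setReg x ((P.run s').reg x + 1)
  suffices H : ∀ i ≤ s.reg b, (F^[i] (s.setReg x 0)).reg x = i ∧
      (∀ r ∉ P.regs, r ≠ x → (F^[i] (s.setReg x 0)).reg r = s.reg r) ∧
      (∀ a ∉ P.arrs, (F^[i] (s.setReg x 0)).arr a = s.arr a) ∧ inv i (F^[i] (s.setReg x 0)) from
    (H _ le_rfl).2.2.2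
  intro i
  induction i with
  | zero => exact fun _ => ⟨by simp, fun r _ hr => by simp [hr], fun a _ => by simp, h0⟩
  | succ i ih =>
    intro hi
    obtain ⟨h1, h2, h3, h4⟩ := ih (by omega)
    rw [Function.iterate_succ_apply']
    set s' := F^[i] (s.setReg x 0)
    have hF : F s' = (P.run s').setReg x (i + 1) := by
      change (P.run s').setReg x ((P.run s').reg x + 1) = _
      rw [run_reg _ hx, h1]
    rw [hF]
    refine ⟨by simp, fun r hr hrx => ?_, fun a ha => ?_, hstep i (by omega) s' h1 h2 h3 h4⟩
    · rw [State.setReg_reg, if_neg hrx, run_reg _ hr, h2 r hr hrx]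
    · rw [State.setReg_arr, run_arr _ ha, h3 a ha]

end Stmt

/-- A function is computable in polynomial time if it is computed by a loop-free program followed
by a well-formed program whose loop bounds are at most the input size. -/
theorem polyTimeComputable_of_run {α : Type} {enc : α → List ℕ} {f : α → α} (C : List ℕ)
    (P Q : Stmt) (hP : P.WF []) (hQ : Q.WF C)
    (hC : ∀ x, ∀ c ∈ C, (P.run (initial (enc x))).reg c ≤ wordSize (enc x))
    (hf : ∀ x, (Q.run (P.run (initial (enc x)))).out = enc (f x)) :
    PolyTimeComputable enc f := by
  refine ⟨(P ;; Q).toProgram, P.time + Q.time, fun x => ?_⟩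
  obtain ⟨t, ht, h1⟩ := Stmt.exists_exec (N := wordSize (enc x)) P (initial (enc x)) hP (by simp)
  obtain ⟨t', ht', h2⟩ := Stmt.exists_exec Q _ hQ (hC x)
  exact ⟨t + t', _, .seq h1 h2, hf x, by rw [Polynomial.eval_add]; omega⟩

end RAM

/-! ### Scores of committees in a finite profile -/

section Profile

open Finset

theorem harmonic_mono : Monotone harmonic :=
  monotone_nat_of_le_succ fun n => by
    rw [harmonic_succ]
    exact le_add_of_nonneg_right (by positivity)

theorem harmonic_succ_le (n : ℕ) : harmonic (n + 1) ≤ harmonic n + 1 := by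
  rw [harmonic_succ]
  gcongr
  exact inv_le_one_of_one_le₀ (by simp)

theorem harmonic_le_self (n : ℕ) : harmonic n ≤ n := by
  induction n with
  | zero => simp
  | succ n ih => push_cast; linarith [harmonic_succ_le n]

theorem one_le_harmonic {n : ℕ} (hn : n ≠ 0) : 1 ≤ harmonic n := by
  simpa using harmonic_mono (Nat.one_le_iff_ne_zero.2 hn)

theorem harmonic_nonneg (n : ℕ) : 0 ≤ harmonic n := by
  simpa using harmonic_mono n.zero_le

theorem exists_harmonic_eq_div_factorial {n b : ℕ} (h : n ≤ b) :
    ∃ x : ℕ, harmonic n = x / b.factorial := by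
  refine ⟨∑ i ∈ range n, b.factorial / (i + 1), ?_⟩
  rw [harmonic, Nat.cast_sum, sum_div]
  refine sum_congr rfl fun i hi => ?_
  have hi : i < n := mem_range.1 hi
  rw [Nat.cast_div (Nat.dvd_factorial (by omega) (by omega)) (by positivity)]
  field_simp

variable {ι α : Type*} {V : Finset ι} {B : ι → α → Prop} [∀ i, DecidablePred (B i)]

/-- The PAV score of the committee `W` with respect to the voters in `V`, where `B i a` says that
voter `i` approves of alternative `a`. -/
def pavScore (V : Finset ι) (B : ι → α → Prop) [∀ i, DecidablePred (B i)] (W : Finset α) : ℚ :=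
  ∑ i ∈ V, harmonic #{a ∈ W | B i a}

theorem pavScore_mono {W W' : Finset α} (h : W ⊆ W') : pavScore V B W ≤ pavScore V B W' :=
  sum_le_sum fun _ _ => harmonic_mono (card_le_card (filter_subset_filter _ h))

theorem pavScore_le {W : Finset α} : pavScore V B W ≤ (#V * #W : ℕ) := by
  rw [pavScore, ← smul_eq_mul, ← sum_const, Nat.cast_sum]
  exact sum_le_sum fun i _ =>
    (harmonic_le_self _).trans (Nat.cast_le.2 (card_le_card (filter_subset _ _)))

/-- Every committee that contains an alternative scores at least its number of approvals. -/
theorem card_le_pavScore {W : Finset α} {a : α} (ha : a ∈ W) :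
    (#{i ∈ V | B i a} : ℚ) ≤ pavScore V B W := by
  rw [card_filter, Nat.cast_sum]
  refine sum_le_sum fun i _ => ?_
  split_ifs with h
  · rw [Nat.cast_one]
    exact one_le_harmonic (card_ne_zero_of_mem (mem_filter.2 ⟨ha, h⟩))
  · simpa using harmonic_nonneg _

/-- Scores are multiples of `1 / b!` if nobody approves of more than `b` members. -/
theorem exists_pavScore_eq_div_factorial {W : Finset α} {b : ℕ}
    (hb : ∀ i ∈ V, #{a ∈ W | B i a} ≤ b) : ∃ x : ℕ, pavScore V B W = x / b.factorial := by
  choose! x hx using fun i hi => exists_harmonic_eq_div_factorial (hb i hi)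
  refine ⟨∑ i ∈ V, x i, ?_⟩
  rw [pavScore, Nat.cast_sum, sum_div]
  exact sum_congr rfl hx

/-- Voters who approve of nobody in `R` can be dropped. -/
theorem pavScore_filter_exists {R W : Finset α} (hW : W ⊆ R) :
    pavScore {i ∈ V | ∃ a ∈ R, B i a} B W = pavScore V B W := by
  refine sum_filter_of_ne fun i _ hi => ?_
  by_contra! h
  rw [filter_false_of_mem fun a ha => h a (hW ha)] at hi
  simp at hi

theorem card_filter_exists_le {R : Finset α} {s : ℕ} (hdeg : ∀ a ∈ R, #{i ∈ V | B i a} ≤ s) :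
    #{i ∈ V | ∃ a ∈ R, B i a} ≤ #R * s := by
  classical
  refine (card_le_card fun i hi => ?_).trans (card_biUnion_le_card_mul R _ s hdeg)
  simp only [mem_filter, mem_biUnion] at hi ⊢
  tauto

variable [DecidableEq α]

theorem pavScore_insert_le (W : Finset α) (a : α) :
    pavScore V B (insert a W) ≤ pavScore V B W + #{i ∈ V | B i a} := by
  rw [card_filter, Nat.cast_sum, pavScore, pavScore, ← sum_add_distrib]
  refine sum_le_sum fun i _ => ?_
  rw [filter_insert]
  split_ifs with h
  · refine (harmonic_mono (card_insert_le _ _)).trans ?_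
    simpa using harmonic_succ_le _
  · simp

/-- An alternative that shares no voter with `W` contributes its number of approvals. -/
theorem pavScore_insert_of_disjoint {W : Finset α} {a : α}
    (h : ∀ i ∈ V, B i a → ∀ c ∈ W, ¬ B i c) :
    pavScore V B W + #{i ∈ V | B i a} ≤ pavScore V B (insert a W) := by
  rw [card_filter, Nat.cast_sum, pavScore, pavScore, ← sum_add_distrib]
  refine sum_le_sum fun i hi => ?_
  rw [filter_insert]
  split_ifs with hia
  · rw [filter_false_of_mem (h i hi hia)]
    simp
  · simp

/-- Every committee contains a small committee whose score is at least `S`, if its own score is: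
either `s` voters are represented, and one representative of each of them suffices, or fewer than
`s` voters are, and the alternatives that they approve of suffice. -/
theorem exists_small_subset {W : Finset α} {b s : ℕ} {S : ℚ} (hS : S ≤ s)
    (hb : ∀ i ∈ V, #{a ∈ W | B i a} ≤ b) (hW : S ≤ pavScore V B W) :
    ∃ W₀ ⊆ W, #W₀ ≤ s * (b + 1) ∧ S ≤ pavScore V B W₀ := by
  classical
  set U := {i ∈ V | ∃ a ∈ W, B i a} with hU
  rcases le_or_gt s #U with hs | hs
  · obtain ⟨T, hTU, hT⟩ := exists_subset_card_eq hs
    have hc : ∀ i ∈ T, ∃ a ∈ W, B i a := fun i hi => (mem_filter.1 (hTU hi)).2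
    choose c hcW hcB using hc
    refine ⟨T.attach.image fun i : {i // i ∈ T} => c i i.2,
      image_subset_iff.2 fun i _ => hcW i i.2, ?_, hS.trans ?_⟩
    · refine (card_image_le.trans (card_attach.trans hT).le).trans ?_
      exact Nat.le_mul_of_pos_right _ (by omega)
    · calc (s : ℚ) = ∑ i ∈ T, 1 := by rw [sum_const, hT, nsmul_one]
        _ ≤ ∑ i ∈ T, harmonic _ := sum_le_sum fun i hi => one_le_harmonic <| card_ne_zero_of_mem <|
          mem_filter.2 ⟨mem_image_of_mem (fun i : {i // i ∈ T} => c i i.2) (mem_attach T ⟨i, hi⟩),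
            hcB i hi⟩
        _ ≤ _ := sum_le_sum_of_subset_of_nonneg (hTU.trans (filter_subset _ _))
          fun i _ _ => harmonic_nonneg _
  · refine ⟨U.biUnion fun i => {a ∈ W | B i a}, ?_, ?_, hW.trans_eq ?_⟩
    · exact biUnion_subset.2 fun i _ => filter_subset _ _
    · calc _ ≤ #U * b := card_biUnion_le_card_mul _ _ _ fun i hi => hb i (mem_filter.1 hi).1
        _ ≤ s * (b + 1) := Nat.mul_le_mul hs.le (by omega)
    · refine sum_congr rfl fun i hi => congrArg (fun A => harmonic (card A)) ?_
      ext a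
      simp only [mem_filter, mem_biUnion, hU]
      constructor
      · rintro ⟨ha, hia⟩
        exact ⟨⟨i, ⟨hi, a, ha, hia⟩, ha, hia⟩, hia⟩
      · rintro ⟨⟨_, _, ha, _⟩, hia⟩
        exact ⟨ha, hia⟩

/-- The exchange argument. Suppose that `R` consists of alternatives that have at least as many
approvals as those outside `R`. A member of a committee outside `R` can be replaced by an
alternative in `R` that shares no voter with the other members; one exists because, with few
approvals per alternative and per voter, the other members exclude few alternatives only. -/
theorem exists_subset_pavScore_ge {X R : Finset α} {b s w : ℕ}
    (hrow : ∀ i ∈ V, #{a ∈ X | B i a} ≤ b) (hdeg : ∀ a ∈ X, #{i ∈ V | B i a} ≤ s) (hRX : R ⊆ X)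
    (htop : ∀ a ∈ X, a ∉ R → w * (s * b + 1) ≤ #R ∧ ∀ c ∈ R, #{i ∈ V | B i a} ≤ #{i ∈ V | B i c})
    (W : Finset α) (hWX : W ⊆ X) (hw : #W ≤ w) :
    ∃ W₁ ⊆ R, #W₁ ≤ #W ∧ pavScore V B W ≤ pavScore V B W₁ := by
  induction hn : #(W \ R) generalizing W with
  | zero => exact ⟨W, sdiff_eq_empty_iff_subset.1 (card_eq_zero.1 hn), le_rfl, le_rfl⟩
  | succ n ih =>
    obtain ⟨a, ha⟩ := card_pos.1 (hn ▸ n.succ_pos : 0 < #(W \ R))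
    obtain ⟨haW, haR⟩ := mem_sdiff.1 ha
    obtain ⟨hK, htop⟩ := htop a (hWX haW) haR
    set W' := W.erase a
    have hW' : #W' + 1 = #W := card_erase_add_one haW
    set bad := W'.biUnion fun c => insert c ({i ∈ V | B i c}.biUnion fun i => {d ∈ X | B i d})
    have hbad : #bad ≤ #W' * (s * b + 1) := card_biUnion_le_card_mul _ _ _ fun c hc => by
      refine (card_insert_le _ _).trans (Nat.succ_le_succ ?_)
      refine (card_biUnion_le_card_mul _ _ b fun i hi => hrow i (mem_filter.1 hi).1).trans ?_
      exact Nat.mul_le_mul_right _ (hdeg c (hWX (mem_of_mem_erase hc)))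
    have hlt : #bad < #R := by
      refine (hbad.trans_lt ?_).trans_le hK
      exact Nat.mul_lt_mul_of_pos_right (by omega) (by omega)
    obtain ⟨d, hdR, hd⟩ := exists_mem_notMem_of_card_lt_card hlt
    have hdW : d ∉ W' := fun h => hd (mem_biUnion.2 ⟨d, h, mem_insert_self _ _⟩)
    have hdisj : ∀ i ∈ V, B i d → ∀ c ∈ W', ¬ B i c := fun i hi hid c hc hic =>
      hd (mem_biUnion.2 ⟨c, hc, mem_insert_of_mem (mem_biUnion.2
        ⟨i, mem_filter.2 ⟨hi, hic⟩, mem_filter.2 ⟨hRX hdR, hid⟩⟩)⟩)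
    have hcard : #(insert d W') = #W := by rw [card_insert_of_notMem hdW, hW']
    obtain ⟨W₁, hW₁, hle, hsc⟩ := ih (insert d W')
      (insert_subset (hRX hdR) ((erase_subset _ _).trans hWX)) (hcard ▸ hw) (by
        rw [insert_sdiff_of_mem _ hdR, erase_sdiff_comm, card_erase_of_mem ha, hn]; rfl)
    refine ⟨W₁, hW₁, hcard ▸ hle, ?_⟩
    calc pavScore V B W = pavScore V B (insert a W') := by rw [insert_erase haW]
      _ ≤ pavScore V B W' + #{i ∈ V | B i a} := pavScore_insert_le _ _
      _ ≤ pavScore V B W' + #{i ∈ V | B i d} := add_le_add le_rfl (Nat.cast_le.2 (htop d hdR))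
      _ ≤ pavScore V B (insert d W') := pavScore_insert_of_disjoint hdisj
      _ ≤ _ := hsc

/-- If `R` consists of sufficiently many of the alternatives with the most approvals, then only
these alternatives need to be considered. -/
theorem exists_committee_iff {X R : Finset α} {b s k : ℕ} {S : ℚ} (hS : S ≤ s)
    (hrow : ∀ i ∈ V, #{a ∈ X | B i a} ≤ b) (hdeg : ∀ a ∈ X, #{i ∈ V | B i a} ≤ s) (hRX : R ⊆ X)
    (htop : ∀ a ∈ X, a ∉ R → s * (b + 1) * (s * b + 1) ≤ #R ∧
      ∀ c ∈ R, #{i ∈ V | B i a} ≤ #{i ∈ V | B i c}) (hk : k ≤ #X) :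
    (∃ W ⊆ R, #W = min k #R ∧ S ≤ pavScore V B W) ↔
      ∃ W ⊆ X, #W = k ∧ S ≤ pavScore V B W := by
  constructor
  · rintro ⟨W, hW, hc, hsc⟩
    obtain ⟨W', hWW', hW'X, hc'⟩ := exists_subsuperset_card_eq (hW.trans hRX) (by omega) hk
    exact ⟨W', hW'X, hc', hsc.trans (pavScore_mono hWW')⟩
  · rintro ⟨W, hW, hc, hsc⟩
    obtain ⟨W₀, hW₀, hc₀, hsc₀⟩ := exists_small_subset hS
      (fun i hi => (card_le_card (filter_subset_filter _ hW)).trans (hrow i hi)) hsc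
    obtain ⟨W₁, hW₁, hc₁, hsc₁⟩ := exists_subset_pavScore_ge hrow hdeg hRX htop W₀
      (hW₀.trans hW) hc₀
    have := card_le_card hW₀
    have := card_le_card hW₁
    obtain ⟨W', hWW', hW', hc'⟩ :=
      exists_subsuperset_card_eq hW₁ (n := min k #R) (by omega) (by omega)
    exact ⟨W', hW', hc', (hsc₀.trans hsc₁).trans (pavScore_mono hWW')⟩

end Profile

/-! ### The alternatives with the most approvals -/

section Rank

open Finset

variable {α γ : Type*} [LinearOrder γ] {X : Finset α} {key : α → γ}

theorem card_filter_key_lt_strictAntiOn {a c : α} (hc : c ∈ X) (h : key a < key c) :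
    #{d ∈ X | key c < key d} < #{d ∈ X | key a < key d} := by
  refine card_lt_card (ssubset_iff_of_subset (fun d hd => ?_) |>.2
    ⟨c, mem_filter.2 ⟨hc, h⟩, by simp⟩)
  rw [mem_filter] at hd ⊢
  exact ⟨hd.1, h.trans hd.2⟩

theorem injOn_card_filter_key_lt (hkey : Set.InjOn key X) :
    Set.InjOn (fun a => #{d ∈ X | key a < key d}) X := by
  intro a ha c hc h
  by_contra hne
  rcases lt_or_gt_of_ne fun e => hne (hkey ha hc e) with h' | h'
  · exact (card_filter_key_lt_strictAntiOn hc h').ne' h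
  · exact (card_filter_key_lt_strictAntiOn ha h').ne h

/-- At most `K` elements have rank less than `K`, where the rank of an element is the number of
elements with a larger key. -/
theorem card_filter_rank_le (hkey : Set.InjOn key X) (K : ℕ) :
    #{a ∈ X | #{d ∈ X | key a < key d} < K} ≤ K := by
  rw [← card_range K]
  exact card_le_card_of_injOn (fun a => #{d ∈ X | key a < key d})
    (fun a ha => by simpa using (mem_filter.1 ha).2)
    ((injOn_card_filter_key_lt hkey).mono (filter_subset _ _))

/-- Unless all elements have rank less than `K`, exactly `K` of them do: the ranks are the numbers
less than the number of elements. -/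
theorem le_card_filter_rank (hkey : Set.InjOn key X) {K : ℕ} {a : α} (ha : a ∈ X)
    (hK : K ≤ #{d ∈ X | key a < key d}) :
    K ≤ #{a ∈ X | #{d ∈ X | key a < key d} < K} := by
  classical
  have hmem : ∀ a ∈ X, #{d ∈ X | key a < key d} ∈ range #X := fun a ha =>
    mem_range.2 (card_lt_card (filter_ssubset.2 ⟨a, ha, lt_irrefl _⟩))
  have himg : X.image (fun a => #{d ∈ X | key a < key d}) = range #X :=
    eq_of_subset_of_card_le (image_subset_iff.2 hmem)
      (by rw [card_range, card_image_of_injOn (injOn_card_filter_key_lt hkey)])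
  have hsub : range K ⊆ {a ∈ X | #{d ∈ X | key a < key d} < K}.image
      (fun a => #{d ∈ X | key a < key d}) := fun j hj => by
    have hjX : j ∈ X.image (fun a => #{d ∈ X | key a < key d}) := by
      rw [himg, mem_range]
      exact (mem_range.1 hj).trans_le (hK.trans (mem_range.1 (hmem a ha)).le)
    obtain ⟨c, hc, rfl⟩ := mem_image.1 hjX
    exact mem_image_of_mem _ (mem_filter.2 ⟨hc, mem_range.1 hj⟩)
  simpa using (card_le_card hsub).trans card_image_le

end Rank

/-! ### The kernel -/

namespace PAVInstance

open Finset

variable (I : PAVInstance)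

/-- Voter `i` approves of alternative `a`, as a relation between natural numbers. -/
def Approves (i a : ℕ) : Prop :=
  ∃ (hi : i < I.n) (ha : a < I.m), (⟨a, ha⟩ : Fin I.m) ∈ I.approval ⟨i, hi⟩

instance (i a : ℕ) : Decidable (I.Approves i a) :=
  inferInstanceAs (Decidable (∃ (hi : i < I.n) (ha : a < I.m),
    (⟨a, ha⟩ : Fin I.m) ∈ I.approval ⟨i, hi⟩))

/-- The number of voters who approve of `a`. -/
def degree (a : ℕ) : ℕ := #{i ∈ range I.n | I.Approves i a}

/-- Alternatives are compared by the number of their approvals; ties are broken in favour of the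
smaller index. -/
def key (a : ℕ) : ℕ ×ₗ ℕᵒᵈ := toLex (I.degree a, OrderDual.toDual a)

/-- The number of alternatives that are preferable to `a`. -/
def rank (a : ℕ) : ℕ := #{c ∈ range I.m | I.key a < I.key c}

/-- The alternatives that are kept: the best `4 ^ (b + ⌈S⌉)` ones. -/
def kept : List ℕ := (List.range I.m).filter fun a => I.rank a < 4 ^ I.param

/-- The voters that are kept: those who approve of an alternative that is kept. -/
def keptVoters : List ℕ := (List.range I.n).filter fun i => ∃ a ∈ I.kept, I.Approves i a

/-- The instance that is induced by the kept alternatives and voters. The score bound is rounded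
up to the next multiple of `1 / b!`. -/
def restrict : PAVInstance where
  m := I.kept.length
  n := I.keptVoters.length
  approval i := {a | I.Approves (I.keptVoters.get i) (I.kept.get a)}
  k := min I.k I.kept.length
  scoreNum := ⌈I.S * I.b.factorial⌉₊
  scoreDen := I.b.factorial
  scoreDen_pos := I.b.factorial_pos

/-- The instance without alternatives and voters whose score bound is `c`. -/
def const (c : ℕ) : PAVInstance where
  m := 0
  n := 0
  approval _ := ∅
  k := 0
  scoreNum := c
  scoreDen := 1
  scoreDen_pos := one_pos

/-- The kernelization. -/
def kernel : PAVInstance :=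
  if I.m < I.k then const 1
  else if I.scoreNum = 0 then const 0
  else if I.k = 0 then const 1
  else if (I.n * I.m : ℕ) < I.S then const 1
  else if ∃ a < I.m, ⌈I.S⌉₊ ≤ I.degree a then const 0
  else I.restrict

variable {I}

/-- The question in terms of natural numbers as the names of alternatives and voters. -/
theorem isYes_iff {α : Fin I.m → ℕ} (hα : α.Injective) {ν : Fin I.n → ℕ} (hν : ν.Injective)
    {B : ℕ → ℕ → Prop} [∀ i, DecidablePred (B i)]
    (h : ∀ i a, a ∈ I.approval i ↔ B (ν i) (α a)) :
    I.IsYes ↔ ∃ W ⊆ univ.image α, #W = I.k ∧ I.S ≤ pavScore (univ.image ν) B W := by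
  have hscore : ∀ W, I.score W = pavScore (univ.image ν) B (W.image α) := fun W => by
    rw [pavScore, sum_image hν.injOn, score]
    refine sum_congr rfl fun i _ => congrArg harmonic ?_
    rw [filter_image, card_image_of_injective _ hα, inter_comm, ← filter_mem_eq_inter]
    simp only [h]
  constructor
  · rintro ⟨W, hW, hS⟩
    exact ⟨W.image α, image_subset_image (subset_univ _), by rw [card_image_of_injective _ hα, hW],
      hscore W ▸ hS⟩
  · rintro ⟨W, hWα, hW, hS⟩
    obtain ⟨W, -, rfl⟩ := subset_image_iff.1 hWα
    exact ⟨W, by rw [← hW, card_image_of_injective _ hα], hscore W ▸ hS⟩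

theorem isYes_iff_range :
    I.IsYes ↔ ∃ W ⊆ range I.m, #W = I.k ∧ I.S ≤ pavScore (range I.n) I.Approves W := by
  have hr : ∀ n : ℕ, univ.image (Fin.val : Fin n → ℕ) = range n := fun n => by
    ext a; simp only [mem_image, mem_univ, true_and, mem_range]
    exact ⟨fun ⟨i, hi⟩ => hi ▸ i.2, fun h => ⟨⟨a, h⟩, rfl⟩⟩
  rw [isYes_iff Fin.val_injective Fin.val_injective (B := I.Approves)
    fun i a => by simp [Approves], hr, hr]

theorem nodup_kept : I.kept.Nodup := List.nodup_range.filter _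

theorem nodup_keptVoters : I.keptVoters.Nodup := List.nodup_range.filter _

theorem toFinset_kept : I.kept.toFinset = {a ∈ range I.m | I.rank a < 4 ^ I.param} := by
  ext a; simp [kept]

theorem toFinset_keptVoters :
    I.keptVoters.toFinset = {i ∈ range I.n | ∃ a ∈ I.kept.toFinset, I.Approves i a} := by
  ext a; simp [keptVoters]

theorem mem_approval_restrict {i : Fin I.keptVoters.length} {a : Fin I.kept.length} :
    a ∈ I.restrict.approval i ↔ I.Approves (I.keptVoters.get i) (I.kept.get a) :=
  mem_filter_univ (p := fun a => I.Approves (I.keptVoters.get i) (I.kept.get a)) a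

theorem isYes_restrict_iff : I.restrict.IsYes ↔ ∃ W ⊆ I.kept.toFinset,
    #W = min I.k #I.kept.toFinset ∧ I.restrict.S ≤ pavScore (range I.n) I.Approves W := by
  have hl : ∀ l : List ℕ, univ.image l.get = l.toFinset := fun l => by
    ext a; simp [List.mem_iff_get]
  rw [isYes_iff (I := I.restrict) (B := I.Approves)
    (List.nodup_iff_injective_get.1 I.nodup_kept)
    (List.nodup_iff_injective_get.1 I.nodup_keptVoters) fun _ _ => mem_approval_restrict]
  refine exists_congr fun W => ?_
  erw [hl, hl]
  refine and_congr_right fun hW => ?_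
  rw [toFinset_keptVoters, pavScore_filter_exists hW,
    List.toFinset_card_of_nodup nodup_kept]
  rfl

theorem card_filter_approves {i : ℕ} (hi : i < I.n) :
    #{a ∈ range I.m | I.Approves i a} = #(I.approval ⟨i, hi⟩) := by
  rw [← card_map Fin.valEmbedding]
  refine congrArg card (Finset.ext fun a => ?_)
  rw [mem_filter, mem_range, mem_map]
  constructor
  · rintro ⟨ha, _, _, h⟩
    exact ⟨⟨a, ha⟩, h, rfl⟩
  · rintro ⟨a, h, rfl⟩
    exact ⟨a.2, hi, a.2, h⟩

theorem card_filter_approves_le {i : ℕ} (hi : i < I.n) :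
    #{a ∈ range I.m | I.Approves i a} ≤ I.b := by
  rw [card_filter_approves hi]
  exact le_sup (f := fun i => #(I.approval i)) (mem_univ _)

theorem injective_key : Function.Injective I.key := fun _ _ h => 
  congrArg (fun x : ℕ ×ₗ ℕᵒᵈ => OrderDual.ofDual (ofLex x).2) h

theorem length_kept_le : I.kept.length ≤ 4 ^ I.param := by
  rw [← List.toFinset_card_of_nodup nodup_kept, toFinset_kept]
  exact card_filter_rank_le injective_key.injOn _

theorem degree_le_of_mem_kept {a c : ℕ} (ha : a < I.m) (haR : a ∉ I.kept.toFinset)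
    (hc : c ∈ I.kept.toFinset) : I.degree a ≤ I.degree c := by
  simp only [toFinset_kept, mem_filter, mem_range, not_and, not_lt] at haR hc
  by_contra! h
  have hlt : I.key c < I.key a := Prod.Lex.toLex_lt_toLex.2 (Or.inl h)
  exact (hc.2.trans_le (haR ha)).not_gt
    (card_filter_key_lt_strictAntiOn (mem_range.2 ha) hlt)

theorem pow_le_card_kept {a : ℕ} (ha : a < I.m) (haR : a ∉ I.kept.toFinset) :
    4 ^ I.param ≤ #I.kept.toFinset := by
  rw [toFinset_kept] at haR ⊢
  simp only [mem_filter, mem_range, not_and, not_lt] at haR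
  exact le_card_filter_rank injective_key.injOn (mem_range.2 ha) (haR ha)

/-- The number of alternatives that are kept is large enough for the exchange argument. -/
theorem mul_mul_le_four_pow (s b : ℕ) : s * (b + 1) * (s * b + 1) ≤ 4 ^ (b + s) := by
  have hs : s + 1 ≤ 2 ^ s := Nat.lt_two_pow_self
  have hb : b + 1 ≤ 2 ^ b := Nat.lt_two_pow_self
  have h : (s + 1) * (b + 1) ≤ 2 ^ (b + s) := by
    rw [pow_add, mul_comm]; exact Nat.mul_le_mul hb hs
  calc s * (b + 1) * (s * b + 1) ≤ 2 ^ (b + s) * 2 ^ (b + s) :=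
        Nat.mul_le_mul (le_trans (by nlinarith) h) (le_trans (by nlinarith) h)
    _ = 4 ^ (b + s) := by rw [← mul_pow]; norm_num

/-- Rounding the score bound up to a multiple of `1 / b!` does not change the question, since all
scores are such multiples. -/
theorem restrict_S_le_iff {W : Finset ℕ} (hW : W ⊆ range I.m) :
    I.restrict.S ≤ pavScore (range I.n) I.Approves W ↔
      I.S ≤ pavScore (range I.n) I.Approves W := by
  obtain ⟨x, hx⟩ := exists_pavScore_eq_div_factorial (V := range I.n) (B := I.Approves) (W := W)
    (b := I.b) fun i hi => (card_le_card (filter_subset_filter _ hW)).trans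
      (card_filter_approves_le (mem_range.1 hi))
  have hb : (0 : ℚ) < I.b.factorial := by exact_mod_cast I.b.factorial_pos
  rw [hx]
  change (⌈I.S * I.b.factorial⌉₊ : ℚ) / (I.b.factorial : ℚ) ≤ _ ↔ _
  rw [div_le_div_iff_of_pos_right hb, le_div_iff₀ hb, Nat.cast_le, Nat.ceil_le]

theorem isYes_restrict (hk : I.k ≤ I.m) (hdeg : ∀ a < I.m, I.degree a ≤ ⌈I.S⌉₊) :
    I.restrict.IsYes ↔ I.IsYes := by
  have hRX : I.kept.toFinset ⊆ range I.m := toFinset_kept ▸ filter_subset _ _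
  rw [isYes_restrict_iff, isYes_iff_range,
    ← exists_committee_iff (R := I.kept.toFinset) (b := I.b) (Nat.le_ceil I.S)
      (fun i hi => card_filter_approves_le (mem_range.1 hi))
      (fun a ha => hdeg a (mem_range.1 ha)) hRX
      (fun a ha haR => ⟨(mul_mul_le_four_pow _ _).trans (pow_le_card_kept (mem_range.1 ha) haR),
        fun c hc => degree_le_of_mem_kept (mem_range.1 ha) haR hc⟩) (by simpa using hk)]
  exact exists_congr fun W => and_congr_right fun hW => and_congr_right fun _ =>
    restrict_S_le_iff (hW.trans hRX)

theorem isYes_const {c : ℕ} : (const c).IsYes ↔ c = 0 := by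
  simp [isYes_iff_range, const, S, pavScore]

theorem isYes_kernel : I.kernel.IsYes ↔ I.IsYes := by
  unfold kernel
  split_ifs with hk hP hk0 hS hdeg
  · rw [isYes_const]
    simp only [one_ne_zero, false_iff, isYes_iff_range]
    rintro ⟨W, hW, hc, -⟩
    have := card_le_card hW
    rw [card_range] at this
    omega
  · rw [isYes_const]
    simp only [true_iff, isYes_iff_range]
    obtain ⟨W, hW, hc⟩ := exists_subset_card_eq (s := range I.m) (n := I.k) (by simpa using hk)
    refine ⟨W, hW, hc, ?_⟩
    simp only [S, hP, Nat.cast_zero, zero_div]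
    exact sum_nonneg fun _ _ => harmonic_nonneg _
  · rw [isYes_const]
    simp only [one_ne_zero, false_iff, isYes_iff_range, hk0, card_eq_zero]
    rintro ⟨W, -, rfl, h⟩
    refine h.not_gt ?_
    simp only [pavScore, filter_empty, card_empty, harmonic_zero, sum_const_zero]
    exact div_pos (by exact_mod_cast Nat.pos_of_ne_zero hP) (by exact_mod_cast I.scoreDen_pos)
  · rw [isYes_const]
    simp only [one_ne_zero, false_iff, isYes_iff_range]
    rintro ⟨W, hW, -, h⟩
    refine (h.trans pavScore_le).not_gt (lt_of_le_of_lt ?_ hS)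
    rw [card_range]
    have := card_le_card hW
    rw [card_range] at this
    exact Nat.cast_le.2 (Nat.mul_le_mul_left _ this)
  · rw [isYes_const]
    simp only [true_iff, isYes_iff_range]
    obtain ⟨a, ha, hs⟩ := hdeg
    obtain ⟨W, haW, hW, hc⟩ := exists_subsuperset_card_eq (s := {a}) (t := range I.m) (n := I.k)
      (by simpa using ha) (by rw [card_singleton]; omega) (by simpa using hk)
    exact ⟨W, hW, hc, (Nat.ceil_le.1 hs).trans (card_le_pavScore (singleton_subset_iff.1 haW))⟩
  · push Not at hk hdeg
    exact isYes_restrict hk fun a ha => (hdeg a ha).le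

theorem length_encode : I.encode.length = 5 + I.m + I.n * (I.m + 1) := by
  simp [encode, List.length_flatMap]
  ring

theorem wordSize_le {w : List ℕ} {M : ℕ} (h : ∀ x ∈ w, x ≤ M) :
    RAM.wordSize w ≤ w.length * (M + 1) := by
  rw [RAM.wordSize]
  refine (List.sum_le_card_nsmul _ (M + 1) ?_).trans (by simp)
  simp only [List.mem_map, forall_exists_index, and_imp, forall_apply_eq_imp_iff₂]
  exact fun x hx => Nat.succ_le_succ ((Nat.size_le.2 Nat.lt_two_pow_self).trans (h x hx))

theorem wordSize_encode_le {M : ℕ} (hM : 1 ≤ M) (hm : I.m ≤ M) (hn : I.n ≤ M) (hk : I.k ≤ M)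
    (hP : I.scoreNum ≤ M) (hQ : I.scoreDen ≤ M) : RAM.wordSize I.encode ≤ 16 * M ^ 3 := by
  refine (wordSize_le (M := M) fun x hx => ?_).trans ?_
  · simp only [encode, List.mem_append, List.mem_cons, List.not_mem_nil, or_false, List.mem_range,
      List.mem_flatMap, List.mem_map, List.mem_finRange, true_and] at hx
    rcases hx with ((rfl | rfl | rfl | rfl | rfl) | hx) | ⟨i, rfl | ⟨a, rfl⟩⟩
    any_goals assumption
    · omega
    · omega
    · split_ifs <;> omega
  · rw [length_encode]
    calc (5 + I.m + I.n * (I.m + 1)) * (M + 1)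
        ≤ (5 * M ^ 2 + M ^ 2 + M * (M + M)) * (M + M) := by
          gcongr
          · nlinarith
          · nlinarith
      _ = 16 * M ^ 3 := by ring

theorem param_const (c : ℕ) : (const c).param = c := by
  simp [param, b, S, const]

theorem param_restrict_le : I.restrict.param ≤ I.param := by
  refine Nat.add_le_add (Finset.sup_le fun i _ => ?_) (Nat.ceil_le.2 ?_)
  · have hi : I.keptVoters.get i < I.n := List.mem_range.1 (List.mem_of_mem_filter
      (List.get_mem I.keptVoters i))
    refine le_trans ?_ (card_filter_approves_le hi)
    refine card_le_card_of_injOn I.kept.get (fun a ha => ?_)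
      (List.nodup_iff_injective_get.1 I.nodup_kept).injOn
    have ha' : I.Approves (I.keptVoters.get i) (I.kept.get a) := 
      mem_approval_restrict.1 ha
    exact mem_filter.2 ⟨mem_range.2 ha'.2.choose, ha'⟩
  · change (⌈I.S * I.b.factorial⌉₊ : ℚ) / (I.b.factorial : ℚ) ≤ _
    rw [div_le_iff₀ (by exact_mod_cast I.b.factorial_pos)]
    refine le_trans (b := ((⌈I.S⌉₊ * I.b.factorial : ℕ) : ℚ)) ?_ (by push_cast; rfl)
    refine Nat.cast_le.2 (Nat.ceil_le.2 ?_)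
    push_cast
    exact mul_le_mul_of_nonneg_right (Nat.le_ceil _) (Nat.cast_nonneg _)

theorem wordSize_restrict_le (hdeg : ∀ a < I.m, I.degree a ≤ ⌈I.S⌉₊) :
    RAM.wordSize I.restrict.encode ≤ 16 * (2 ^ (I.param ^ 2 + 3 * I.param)) ^ 3 := by
  set κ := I.param with hκ
  have hs : ⌈I.S⌉₊ ≤ 2 ^ κ :=
    (show ⌈I.S⌉₊ ≤ κ from Nat.le_add_left _ _).trans Nat.lt_two_pow_self.le
  have hm : I.kept.length ≤ 2 ^ (2 * κ) := by rw [pow_mul]; exact length_kept_le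
  have hM : 2 ^ (2 * κ) ≤ 2 ^ (κ ^ 2 + 3 * κ) := Nat.pow_le_pow_right two_pos (by nlinarith)
  have hb : I.b.factorial ≤ 2 ^ (κ ^ 2) := by
    have hbκ : I.b ≤ κ := Nat.le_add_right _ _
    calc I.b.factorial ≤ I.b ^ I.b := I.b.factorial_le_pow
      _ ≤ (2 ^ κ) ^ I.b := Nat.pow_le_pow_left (hbκ.trans Nat.lt_two_pow_self.le) _
      _ ≤ (2 ^ κ) ^ κ := Nat.pow_le_pow_right (by positivity) hbκ
      _ = 2 ^ (κ ^ 2) := by rw [← pow_mul, sq]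
  refine wordSize_encode_le Nat.one_le_two_pow (hm.trans hM) ?_
    ((min_le_right _ _).trans (hm.trans hM)) ?_
    (hb.trans (Nat.pow_le_pow_right two_pos (by nlinarith)))
  · change I.keptVoters.length ≤ _
    rw [← List.toFinset_card_of_nodup nodup_keptVoters, toFinset_keptVoters]
    refine (card_filter_exists_le (s := 2 ^ κ) fun a ha => ?_).trans ?_
    · rw [toFinset_kept, mem_filter, mem_range] at ha
      exact (hdeg a ha.1).trans hs
    · rw [List.toFinset_card_of_nodup nodup_kept]
      calc _ ≤ 2 ^ (2 * κ) * 2 ^ κ := Nat.mul_le_mul_right _ hm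
        _ = 2 ^ (3 * κ) := by rw [← pow_add]; congr 1; ring
        _ ≤ _ := Nat.pow_le_pow_right two_pos (by nlinarith)
  · change ⌈I.S * I.b.factorial⌉₊ ≤ _
    refine Nat.ceil_le.2 ?_
    calc I.S * I.b.factorial ≤ ((⌈I.S⌉₊ * I.b.factorial : ℕ) : ℚ) := by
          push_cast; exact mul_le_mul_of_nonneg_right (Nat.le_ceil _) (Nat.cast_nonneg _)
      _ ≤ _ := Nat.cast_le.2 ?_
    calc ⌈I.S⌉₊ * I.b.factorial ≤ 2 ^ κ * 2 ^ (κ ^ 2) := Nat.mul_le_mul hs hb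
      _ = 2 ^ (κ + κ ^ 2) := (pow_add _ _ _).symm
      _ ≤ _ := Nat.pow_le_pow_right two_pos (by nlinarith)

theorem kernel_size (I : PAVInstance) :
    RAM.wordSize I.kernel.encode ≤ 2 ^ (3 * (I.param ^ 2 + 3 * I.param) + 4) ∧
      I.kernel.param ≤ 2 ^ (3 * (I.param ^ 2 + 3 * I.param) + 4) := by
  have h16 : 16 ≤ 2 ^ (3 * (I.param ^ 2 + 3 * I.param) + 4) :=
    Nat.pow_le_pow_right (n := 2) two_pos (Nat.le_add_left 4 _)
  have hconst : ∀ c ≤ 1, RAM.wordSize (const c).encode ≤ 16 ∧ (const c).param ≤ 16 :=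
    fun c hc => ⟨by
      simpa using wordSize_encode_le (I := const c) (M := 1) le_rfl (by simp [const])
        (by simp [const]) (by simp [const]) hc le_rfl, by rw [param_const]; omega⟩
  have hc0 := hconst 0 (by norm_num)
  have hc1 := hconst 1 (by norm_num)
  unfold kernel
  split_ifs with hk hP hk0 hS hdeg
  iterate 5
    first
      | exact ⟨hc0.1.trans h16, hc0.2.trans h16⟩
      | exact ⟨hc1.1.trans h16, hc1.2.trans h16⟩
  push Not at hdeg
  constructor
  · refine (wordSize_restrict_le fun a ha => (hdeg a ha).le).trans_eq ?_
    rw [← pow_mul, pow_add, mul_comm 3]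
    norm_num [mul_comm]
  · refine param_restrict_le.trans (Nat.lt_two_pow_self.le.trans ?_)
    exact Nat.pow_le_pow_right two_pos (by nlinarith)

end PAVInstance

/-! ### The program -/

namespace PAVInstance

open Finset RAM

-- The numbers of the registers. The registers `rM`, `rN`, `rK`, `rP`, `rQ` hold `m`, `n`, `k` and
-- the fraction `S = P / Q`.
local notation "rM" => 1
local notation "rN" => 2
local notation "rK" => 3
local notation "rP" => 4
local notation "rQ" => 5
-- The position in the input of the first entry of the current row of the approval matrix.
local notation "rRow" => 6
-- The maximum size `b` of an approval set, the number `⌈S⌉` and its product with `Q`, and the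
-- threshold `4 ^ (b + ⌈S⌉)` for the rank.
local notation "rB" => 7
local notation "rS" => 8
local notation "rSQ" => 9
local notation "rT" => 10
-- The numbers of alternatives and voters that are kept, and the number of alternatives with at
-- least `⌈S⌉` approvals.
local notation "rKeptA" => 11
local notation "rKeptV" => 12
local notation "rHigh" => 13
-- The rounded score bound: numerator, denominator, and the rounding error; and accumulators for
-- their products with a number.
local notation "rNum" => 14
local notation "rDen" => 15
local notation "rErr" => 16
local notation "rNumAcc" => 17
local notation "rDenAcc" => 18
local notation "rErrAcc" => 19
-- A local counter, and the loop variables.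
local notation "rC" => 20
local notation "rI" => 21
local notation "rA" => 22
local notation "rJ" => 23
-- The arrays: the input, the degrees, and the characteristic vectors of the alternatives and of the
-- voters that are kept.
local notation "aIn" => 0
local notation "aDeg" => 1
local notation "aKeptA" => 2
local notation "aKeptV" => 3

open Expr Stmt

/-- The entry of the approval matrix for the alternative `rA` in the current row. -/
def entry : Expr := cell aIn (reg rRow + reg rA)

/-- Read `m`, `n`, `k` and `S`. -/
def load : Stmt :=
  assign rM (cell aIn 0) ;; assign rN (cell aIn 1) ;; assign rK (cell aIn 2) ;;
  assign rP (cell aIn 3) ;; assign rQ (cell aIn 4)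

/-- Go to the first row of the approval matrix. -/
def firstRow : Stmt := assign rRow (6 + reg rM)

/-- Go to the next row of the approval matrix. -/
def nextRow : Stmt := assign rRow (reg rRow + (reg rM + 1))

/-- Add the current row to the degrees and its sum to the counter. -/
def tallyRow : Stmt :=
  loop rA rM
    (store aDeg (reg rA) (cell aDeg (reg rA) + entry) ;; assign rC (reg rC + entry))

/-- Compute the degrees and `b`. -/
def tally : Stmt :=
  firstRow ;;
  loop rI rN
    (assign rC 0 ;; tallyRow ;; assign rB (reg rB + (reg rC - reg rB)) ;; nextRow)

/-- Multiply the threshold by four. -/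
def quadruple : Stmt := assign rT (reg rT + reg rT) ;; assign rT (reg rT + reg rT)

/-- One step of the computation of `⌈S⌉`. -/
def ceilStep : Stmt :=
  ite (reg rP - reg rSQ)
    (assign rSQ (reg rSQ + reg rQ) ;; assign rS (reg rS + 1) ;; quadruple) skip

/-- Compute `min (n * m) ⌈S⌉` and the threshold. -/
def ceiling : Stmt :=
  assign rT 1 ;; loop rI rN (loop rA rM ceilStep) ;;
  loop rA rM (ite (reg rB - reg rA) quadruple skip)

/-- Compute the rank of the alternative `rA`. -/
def rankLoop : Stmt :=
  loop rJ rM (assign rC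
    (reg rC + (1 - ((cell aDeg (reg rA) + (1 - (reg rA - reg rJ))) - cell aDeg (reg rJ)))))

/-- Determine the alternatives that are kept, and those with at least `⌈S⌉` approvals. -/
def selectAlternatives : Stmt :=
  loop rA rM
    (assign rC 0 ;; rankLoop ;;
      store aKeptA (reg rA) (1 - ((reg rC + 1) - reg rT)) ;;
      assign rKeptA (reg rKeptA + cell aKeptA (reg rA)) ;;
      assign rHigh (reg rHigh + (1 - (reg rS - cell aDeg (reg rA)))))

/-- Count the approvals of kept alternatives in the current row. -/
def countRow : Stmt :=
  loop rA rM (ite (cell aKeptA (reg rA)) (assign rC (reg rC + entry)) skip)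

/-- Determine the voters that are kept. -/
def selectVoters : Stmt :=
  firstRow ;;
  loop rI rN
    (assign rC 0 ;; countRow ;;
      store aKeptV (reg rI) (1 - (1 - reg rC)) ;;
      assign rKeptV (reg rKeptV + cell aKeptV (reg rI)) ;; nextRow)

/-- Multiply the denominator by `rJ + 1`, and keep the numerator the ceiling of the product of the
denominator and `S`. -/
def scale : Stmt :=
  assign rNumAcc 0 ;; assign rDenAcc 0 ;; assign rErrAcc 0 ;;
  loop rA rM (ite (reg rJ + 1 - reg rA)
    (assign rNumAcc (reg rNumAcc + reg rNum) ;; assign rDenAcc (reg rDenAcc + reg rDen) ;;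
      assign rErrAcc (reg rErrAcc + reg rErr) ;;
      ite (reg rErrAcc + 1 - reg rQ)
        (assign rErrAcc (reg rErrAcc - reg rQ) ;; assign rNumAcc (reg rNumAcc - 1)) skip) skip) ;;
  assign rNum (reg rNumAcc) ;; assign rDen (reg rDenAcc) ;; assign rErr (reg rErrAcc)

/-- Round the score bound up to a multiple of `1 / b!`. -/
def round : Stmt :=
  assign rNum (reg rS) ;; assign rDen 1 ;; assign rErr (reg rSQ - reg rP) ;;
  loop rJ rM (ite (reg rB - reg rJ) scale skip)

/-- Write `0, 1, …`, one number for each alternative that is kept. -/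
def emitNames : Stmt :=
  assign rC 0 ;;
  loop rA rM (ite (cell aKeptA (reg rA)) (emit (reg rC) ;; assign rC (reg rC + 1)) skip)

/-- Write the entries of the current row for the alternatives that are kept. -/
def emitRow : Stmt := loop rA rM (ite (cell aKeptA (reg rA)) (emit entry) skip)

/-- Write the approval matrix of the restricted instance. -/
def emitMatrix : Stmt :=
  firstRow ;; assign rC 0 ;;
  loop rI rN
    (ite (cell aKeptV (reg rI)) (emit (reg rC) ;; assign rC (reg rC + 1) ;; emitRow) skip ;;
      nextRow)

/-- Write the restricted instance. -/
def emitRestrict : Stmt :=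
  selectVoters ;; round ;;
  emit (reg rKeptA) ;; emit (reg rKeptV) ;; emit (reg rK - (reg rK - reg rKeptA)) ;;
  emit (reg rNum) ;; emit (reg rDen) ;; emitNames ;; emitMatrix

/-- Write the instance `const c`. -/
def emitConst (c : Expr) : Stmt := emit 0 ;; emit 0 ;; emit 0 ;; emit c ;; emit 1

/-- Write the kernel. -/
def emitKernel : Stmt :=
  ite (reg rK - reg rM) (emitConst 1) <|
  ite (reg rP) (ite (reg rK) (ite (reg rP - reg rSQ) (emitConst 1)
    (ite (reg rHigh) (emitConst 0) emitRestrict)) (emitConst 1)) (emitConst 0)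

/-- The kernelization program, without the initial reading of the numbers. -/
def kernelStmt : Stmt := tally ;; ceiling ;; selectAlternatives ;; emitKernel

/-- The state `s` holds the instance `I`. -/
structure Loaded (I : PAVInstance) (s : State) : Prop where
  m : s.reg rM = I.m
  n : s.reg rN = I.n
  k : s.reg rK = I.k
  P : s.reg rP = I.scoreNum
  Q : s.reg rQ = I.scoreDen
  row : ∀ i < I.n, ∀ a < I.m,
    s.arr aIn (6 + I.m + i * (I.m + 1) + a) = if I.Approves i a then 1 else 0

variable {I : PAVInstance} {s : State}

theorem Loaded.of_eq {s' : State} (h : Loaded I s)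
    (hreg : ∀ r ∈ [rM, rN, rK, rP, rQ], s'.reg r = s.reg r) (harr : s'.arr aIn = s.arr aIn) :
    Loaded I s' := by
  simp only [List.forall_mem_cons] at hreg
  obtain ⟨h1, h2, h3, h4, h5, -⟩ := hreg
  exact ⟨h1 ▸ h.m, h2 ▸ h.n, h3 ▸ h.k, h4 ▸ h.P, h5 ▸ h.Q, harr ▸ h.row⟩

theorem Loaded.run (h : Loaded I s) (P : Stmt)
    (hP : (∀ r ∈ [rM, rN, rK, rP, rQ], r ∉ P.regs) ∧ aIn ∉ P.arrs) : Loaded I (P.run s) :=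
  h.of_eq (fun r hr => run_reg s (hP.1 r hr)) (run_arr s hP.2)

/-- The invariant rule for loops that do not change the instance in the memory. -/
theorem Loaded.loop_induction {x b : ℕ} {P : Stmt} (h : Loaded I s) (inv : ℕ → State → Prop)
    (hP : (∀ r ∈ [rM, rN, rK, rP, rQ], r ∉ P.regs ∧ r ≠ x) ∧ aIn ∉ P.arrs)
    (hx : x ∉ P.regs) (h0 : inv 0 (s.setReg x 0))
    (hstep : ∀ i < s.reg b, ∀ s', Loaded I s' → s'.reg x = i →
      (∀ r ∉ P.regs, r ≠ x → s'.reg r = s.reg r) → (∀ a ∉ P.arrs, s'.arr a = s.arr a) →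
      inv i s' → inv (i + 1) ((P.run s').setReg x (i + 1))) :
    inv (s.reg b) ((loop x b P).run s) :=
  Stmt.loop_induction inv hx h0 fun i hi s' hs' hreg harr => hstep i hi s'
    (h.of_eq (fun r hr => hreg r (hP.1 r hr).1 (hP.1 r hr).2) (harr _ hP.2)) hs' hreg harr

/-- Indexing into a concatenation of lists of equal length. -/
theorem getElem?_flatMap_of_length {α β : Type*} {f : α → List β} {L : ℕ} {l : List α}
    (hf : ∀ x ∈ l, (f x).length = L) {i j : ℕ} (hi : i < l.length) (hj : j < L) :
    (l.flatMap f)[i * L + j]? = (f l[i])[j]? := by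
  induction l generalizing i with
  | nil => simp at hi
  | cons x l ih =>
    simp only [List.mem_cons, forall_eq_or_imp] at hf
    rw [List.flatMap_cons]
    rcases i with _ | i
    · rw [Nat.zero_mul, Nat.zero_add, List.getElem?_append_left (by omega)]
      rfl
    · rw [List.getElem?_append_right (by rw [hf.1, Nat.succ_mul]; omega), hf.1,
        show (i + 1) * L + j - L = i * L + j by rw [Nat.succ_mul]; omega,
        ih hf.2 (by simpa using hi)]
      rfl

theorem loaded_load (I : PAVInstance) : Loaded I (load.run (initial I.encode)) := by
  have hhead : ∀ j < 5, I.encode.getD j 0 = [I.m, I.n, I.k, I.scoreNum, I.scoreDen].getD j 0 :=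
    fun j hj => by
      rw [encode, List.append_assoc, List.getD_append _ _ _ _ (by simpa using hj)]
  refine ⟨?_, ?_, ?_, ?_, ?_, fun i hi a ha => ?_⟩
  · simpa [load, initial] using hhead 0
  · simpa [load, initial] using hhead 1
  · simpa [load, initial] using hhead 2
  · simpa [load, initial] using hhead 3
  · simpa [load, initial] using hhead 4
  · have : (load.run (initial I.encode)).arr aIn = (initial I.encode).arr aIn :=
      run_arr _ (by decide)
    rw [this]
    simp only [initial, if_true]
    rw [List.getD_eq_getElem?_getD, encode, List.getElem?_append_right (by simp; omega)]
    have hidx : 6 + I.m + i * (I.m + 1) + a -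
        ([I.m, I.n, I.k, I.scoreNum, I.scoreDen] ++ List.range I.m).length =
        i * (I.m + 1) + (a + 1) := by
      simp; omega
    rw [hidx, getElem?_flatMap_of_length (by simp) (by simpa using hi) (by omega)]
    simp [ha, hi, Approves]

/-! ### Computing the degrees and the parameter -/

theorem tallyRow_run (h : Loaded I s) {i : ℕ} (hi : i < I.n)
    (hrow : s.reg rRow = 6 + I.m + i * (I.m + 1)) :
    (tallyRow.run s).reg rC = s.reg rC + Nat.count (I.Approves i) I.m ∧
    ∀ a < I.m, (tallyRow.run s).arr aDeg a = s.arr aDeg a + if I.Approves i a then 1 else 0 := by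
  suffices H : (tallyRow.run s).reg rC = s.reg rC + Nat.count (I.Approves i) I.m ∧
      ∀ a, (tallyRow.run s).arr aDeg a = s.arr aDeg a +
        if a < I.m ∧ I.Approves i a then 1 else 0 from
    ⟨H.1, fun a ha => by simpa [ha] using H.2 a⟩
  rw [← h.m]
  refine h.loop_induction (fun j s' => s'.reg rC = s.reg rC + Nat.count (I.Approves i) j ∧
    ∀ a, s'.arr aDeg a = s.arr aDeg a + if a < j ∧ I.Approves i a then 1 else 0)
    (by decide) (by decide) (by simp) ?_
  rintro j hj s' h' hs' hreg - ⟨h1, h2⟩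
  have hentry : entry.eval s' = if I.Approves i j then 1 else 0 := by
    simp [entry, hs', hreg rRow (by decide) (by decide), hrow, h'.row i hi j (h.m ▸ hj)]
  refine ⟨?_, fun a => ?_⟩
  · have (c v : ℕ) : entry.eval (s'.setCell aDeg c v) = entry.eval s' := by simp [entry]
    simp [this, hentry, h1, Nat.count_succ, add_assoc]
  · simp only [run_seq, run_store, run_assign, State.setReg_arr, State.setCell_arr,
      eval_reg, eval_add, eval_cell, hs', hentry, h2, true_and]
    rcases lt_trichotomy a j with ha | rfl | ha
    · simp [ha, ha.ne, ha.trans (Nat.lt_succ_self j)]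
    · simp
    · simp [ha.ne', ha.not_gt, show ¬ a < j + 1 by omega]

theorem b_eq (I : PAVInstance) :
    I.b = (range I.n).sup fun i => Nat.count (I.Approves i) I.m := by
  simp only [Nat.count_eq_card_filter_range]
  refine le_antisymm (Finset.sup_le fun i _ => ?_) (Finset.sup_le fun i hi =>
    card_filter_approves_le (mem_range.1 hi))
  rw [← card_filter_approves i.2]
  exact le_sup (f := fun i => #{a ∈ range I.m | I.Approves i a}) (mem_range.2 i.2)

theorem tally_run (h : Loaded I s) (hB : s.reg rB = 0) (hdeg : ∀ a, s.arr aDeg a = 0) :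
    (tally.run s).reg rB = I.b ∧ ∀ a < I.m, (tally.run s).arr aDeg a = I.degree a := by
  rw [b_eq, tally, run_seq]
  simp only [degree, ← Nat.count_eq_card_filter_range]
  have h₀ : Loaded I (firstRow.run s) := h.run _ (by decide)
  rw [← h₀.n]
  refine And.imp_right And.right (h₀.loop_induction (fun i s' =>
    s'.reg rB = (range i).sup (fun i => Nat.count (I.Approves i) I.m) ∧
    s'.reg rRow = 6 + I.m + i * (I.m + 1) ∧
    ∀ a < I.m, s'.arr aDeg a = Nat.count (I.Approves · a) i) (by decide) (by decide) ?_ ?_)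
  · simp [firstRow, hB, hdeg, h.m]
  rintro i hi s' h' - - - ⟨h1, h2, h3⟩
  obtain ⟨hC, hdeg⟩ := tallyRow_run (s := s'.setReg rC 0) (h'.run (assign rC 0) (by decide))
    (h₀.n ▸ hi) (by simpa using h2)
  have hR : (tallyRow.run (s'.setReg rC 0)).reg rRow = s'.reg rRow := run_reg _ (by decide)
  have hB : (tallyRow.run (s'.setReg rC 0)).reg rB = s'.reg rB := run_reg _ (by decide)
  have hM : (tallyRow.run (s'.setReg rC 0)).reg rM = s'.reg rM := run_reg _ (by decide)
  refine ⟨?_, ?_, fun a ha => ?_⟩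
  · simp [nextRow, hC, hB, h1, range_add_one, sup_insert]
    omega
  · simp [nextRow, hR, hM, h2, h'.m]
    ring
  · simp [nextRow, hdeg a ha, h3 a ha, Nat.count_succ]

/-- As long as `⌈S⌉` has not been reached, a step increments it and adds the denominator to the
product. -/
theorem ceilStep_run (h : Loaded I s) {c : ℕ} (hSQ : s.reg rSQ = s.reg rS * I.scoreDen)
    (hlt : s.reg rSQ < I.scoreNum + I.scoreDen) (hle : s.reg rS ≤ c)
    (hc : s.reg rSQ < I.scoreNum → s.reg rS = c) (hT : s.reg rT = 4 ^ s.reg rS) :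
    let s' := ceilStep.run s
    s'.reg rSQ = s'.reg rS * I.scoreDen ∧ s'.reg rSQ < I.scoreNum + I.scoreDen ∧
      s'.reg rS ≤ c + 1 ∧ (s'.reg rSQ < I.scoreNum → s'.reg rS = c + 1) ∧
      s'.reg rT = 4 ^ s'.reg rS := by
  intro s'
  by_cases hs : I.scoreNum ≤ s.reg rSQ
  · have : s' = s := by simp [s', ceilStep, h.P, Nat.sub_eq_zero_of_le hs]
    rw [this]
    exact ⟨hSQ, hlt, by omega, by omega, hT⟩
  · have hs' : I.scoreNum - s.reg rSQ ≠ 0 := by omega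
    have := hc (by omega)
    simp [s', ceilStep, quadruple, h.P, h.Q, hs']
    refine ⟨by rw [hSQ]; ring, by omega, by omega, by omega, by rw [hT]; ring⟩

/-- Either `⌈S⌉` has been computed, or the product is still less than the numerator, in which case
`S` exceeds `n * m`. -/
theorem ceiling_run (h : Loaded I s) (hSQ : s.reg rSQ = 0) (hS : s.reg rS = 0) {b : ℕ}
    (hB : s.reg rB = b) (hb : b ≤ I.m) :
    let s' := ceiling.run s
    s'.reg rSQ = s'.reg rS * I.scoreDen ∧ s'.reg rSQ < I.scoreNum + I.scoreDen ∧
      s'.reg rS ≤ I.n * I.m ∧ (s'.reg rSQ < I.scoreNum → s'.reg rS = I.n * I.m) ∧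
      s'.reg rT = 4 ^ (b + s'.reg rS) := by
  intro s'
  set s₁ := (assign rT 1).run s with hs₁
  have h₁ : Loaded I s₁ := h.run _ (by decide)
  let inv (c : ℕ) (s' : State) : Prop :=
    s'.reg rSQ = s'.reg rS * I.scoreDen ∧ s'.reg rSQ < I.scoreNum + I.scoreDen ∧
      s'.reg rS ≤ c ∧ (s'.reg rSQ < I.scoreNum → s'.reg rS = c) ∧ s'.reg rT = 4 ^ s'.reg rS
  have hQ := I.scoreDen_pos
  set s₂ := (loop rI rN (loop rA rM ceilStep)).run s₁ with hs₂
  have h₂ : Loaded I s₂ := h₁.run _ (by decide)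
  have key : inv (I.n * I.m) s₂ := by
    rw [← h₁.n]
    refine h₁.loop_induction (fun i => inv (i * I.m)) (by decide) (by decide) ?_ ?_
    · simp [inv, hs₁, hSQ, hS]; omega
    rintro i - s' h' - - - hi
    have : inv ((i + 1) * I.m) ((loop rA rM ceilStep).run s') := by
      rw [add_mul, one_mul, ← h'.m]
      refine h'.loop_induction (fun j => inv (i * s'.reg rM + j)) (by decide) (by decide) ?_ ?_
      · simpa [inv, h'.m] using hi
      rintro j - s'' h'' - - - ⟨h1, h2, h3, h4, h5⟩
      simpa [inv, add_assoc] using ceilStep_run h'' h1 h2 h3 h4 h5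
    simpa [inv] using this
  obtain ⟨h1, h2, h3, h4, h5⟩ := key
  have e : s' = (loop rA rM (ite (reg rB - reg rA) quadruple skip)).run s₂ := rfl
  have eS : s'.reg rS = s₂.reg rS := by rw [e]; exact run_reg _ (by decide)
  have eSQ : s'.reg rSQ = s₂.reg rSQ := by rw [e]; exact run_reg _ (by decide)
  have eB : s₂.reg rB = b := by
    rw [hs₂, run_reg _ (by decide), hs₁, run_reg _ (by decide), hB]
  have eT : s'.reg rT = 4 ^ (min b (s₂.reg rM) + s₂.reg rS) := by
    rw [e]
    refine h₂.loop_induction (fun j s' => s'.reg rT = 4 ^ (min b j + s₂.reg rS))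
      (by decide) (by decide) (by simpa using h5) ?_
    rintro j - s'' h'' hj hreg - hT
    have hB' : s''.reg rB = b := by rw [hreg rB (by decide) (by decide), eB]
    by_cases hbj : b ≤ j
    · simp [hB', hj, Nat.sub_eq_zero_of_le hbj, hT, hbj, hbj.trans (Nat.le_succ j)]
    · have hbj' : b - j ≠ 0 := by omega
      simp only [run_ite, eval_sub, eval_reg, hB', hj, hbj', if_false, quadruple, run_seq,
        run_assign, State.setReg_reg, eval_add, if_true]
      simp only [hT, show min b j = j by omega, show min b (j + 1) = j + 1 by omega]
      norm_num
      ring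
  rw [eS, eSQ, eT, h₂.m, min_eq_left hb]
  exact ⟨h1, h2, h3, h4, rfl⟩

/-! ### Selecting the alternatives and the voters -/

/-- The comparison of keys in the arithmetic of the machine: `1 - (a - c)` is `1` if `a ≤ c`, and
`0` otherwise. -/
theorem key_lt_key_iff {a c : ℕ} :
    I.key a < I.key c ↔ I.degree a + (1 - (a - c)) ≤ I.degree c := by
  rw [key, key, Prod.Lex.toLex_lt_toLex, OrderDual.toDual_lt_toDual]
  dsimp only
  omega

theorem rankLoop_run (h : Loaded I s) (hdeg : ∀ a < I.m, s.arr aDeg a = I.degree a)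
    (hA : s.reg rA < I.m) (hC : s.reg rC = 0) :
    (rankLoop.run s).reg rC = I.rank (s.reg rA) := by
  rw [rank, ← Nat.count_eq_card_filter_range, ← h.m]
  refine h.loop_induction (fun j s' => s'.reg rC = Nat.count (I.key (s.reg rA) < I.key ·) j)
    (by decide) (by decide) (by simpa using hC) ?_
  rintro j hj s' h' hs' hreg harr hC
  have hA' : s'.reg rA = s.reg rA := hreg rA (by decide) (by decide)
  have hdeg' : ∀ a < I.m, s'.arr aDeg a = I.degree a := fun a ha => by
    rw [harr aDeg (by decide), hdeg a ha]
  simp only [run_assign, State.setReg_reg, eval_add, eval_sub, eval_reg, eval_cell, eval_one, hA',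
    hs', hC, hdeg' _ hA, hdeg' j (h.m ▸ hj), Nat.count_succ, key_lt_key_iff]
  split_ifs <;> simp at * <;> omega

theorem selectAlternatives_run (h : Loaded I s) (hdeg : ∀ a < I.m, s.arr aDeg a = I.degree a)
    (hK : s.reg rKeptA = 0) (hH : s.reg rHigh = 0) :
    let s' := selectAlternatives.run s
    (∀ a < I.m, s'.arr aKeptA a = if I.rank a < s.reg rT then 1 else 0) ∧
      s'.reg rKeptA = Nat.count (I.rank · < s.reg rT) I.m ∧
      s'.reg rHigh = Nat.count (s.reg rS ≤ I.degree ·) I.m := by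
  rw [← h.m]
  refine h.loop_induction (fun j s' =>
    (∀ a < j, s'.arr aKeptA a = if I.rank a < s.reg rT then 1 else 0) ∧
      s'.reg rKeptA = Nat.count (I.rank · < s.reg rT) j ∧
      s'.reg rHigh = Nat.count (s.reg rS ≤ I.degree ·) j)
    (by decide) (by decide) (by simp [hK, hH]) ?_
  rintro j hj s' h' hs' hreg harr ⟨h1, h2, h3⟩
  have hdeg' : ∀ a < I.m, s'.arr aDeg a = I.degree a := fun a ha => by
    rw [harr aDeg (by decide), hdeg a ha]
  set s₁ := (assign rC 0 ;; rankLoop).run s' with hs₁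
  have hR : s₁.reg rC = I.rank j := by
    have := rankLoop_run (s := s'.setReg rC 0) (h'.run (assign rC 0) (by decide)) hdeg'
      (by simpa [hs'] using h.m ▸ hj) (by simp)
    simpa [hs₁, hs'] using this
  have hfr : ∀ r ∉ (assign rC 0 ;; rankLoop).regs, s₁.reg r = s'.reg r := fun r => run_reg s'
  have hA₁ := hfr rA (by decide)
  have hK₁ := hfr rKeptA (by decide)
  have hH₁ := hfr rHigh (by decide)
  have hT₁ : s₁.reg rT = s.reg rT := (hfr rT (by decide)).trans (hreg rT (by decide) (by decide))
  have hS₁ : s₁.reg rS = s.reg rS := (hfr rS (by decide)).trans (hreg rS (by decide) (by decide))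
  have hD₁ : s₁.arr aDeg = s'.arr aDeg := run_arr s' (by decide)
  have hP₁ : s₁.arr aKeptA = s'.arr aKeptA := run_arr s' (by decide)
  rw [run_seq] at hs₁
  rw [run_seq, run_seq, ← hs₁]
  have e1 (x y : ℕ) : (1 - (x + 1 - y)) = if x < y then 1 else 0 := by split_ifs <;> omega
  have e2 (x y : ℕ) : (1 - (x - y)) = if x ≤ y then 1 else 0 := by split_ifs <;> omega
  refine ⟨fun a ha => ?_, ?_, ?_⟩
  · rcases Nat.lt_succ_iff_lt_or_eq.1 ha with ha | rfl
    · simp [hA₁, hs', ha.ne, hP₁, h1 a ha]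
    · simp [hA₁, hs', hR, hT₁, e1]
  · simp [hA₁, hs', hR, hT₁, e1, hK₁, h2, Nat.count_succ]
  · simp [hA₁, hs', hS₁, hD₁, hdeg' j (h.m ▸ hj), e2, hH₁, h3, Nat.count_succ]

section Restrict

variable {p v : ℕ → Prop} [DecidablePred p] [DecidablePred v]

theorem countRow_run (h : Loaded I s) (hp : ∀ a < I.m, s.arr aKeptA a = if p a then 1 else 0)
    {i : ℕ} (hi : i < I.n) (hrow : s.reg rRow = 6 + I.m + i * (I.m + 1)) (hC : s.reg rC = 0) :
    (countRow.run s).reg rC = Nat.count (fun a => p a ∧ I.Approves i a) I.m := by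
  rw [← h.m]
  refine h.loop_induction
    (fun j s' => s'.reg rC = Nat.count (fun a => p a ∧ I.Approves i a) j)
    (by decide) (by decide) (by simpa using hC) ?_
  rintro j hj s' h' hs' hreg harr h1
  rw [h.m] at hj
  have hentry : entry.eval s' = if I.Approves i j then 1 else 0 := by
    simp [entry, hs', hreg rRow (by decide) (by decide), hrow, h'.row i hi j hj]
  have hpj : s'.arr aKeptA j = if p j then 1 else 0 := by rw [harr _ (by decide), hp j hj]
  by_cases hj' : p j <;> simp [hs', hpj, hj', hentry, h1, Nat.count_succ]

theorem selectVoters_run (h : Loaded I s)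
    (hp : ∀ a < I.m, s.arr aKeptA a = if p a then 1 else 0) (hK : s.reg rKeptV = 0)
    (hv : ∀ i < I.n, v i ↔ ∃ a < I.m, p a ∧ I.Approves i a) :
    let s' := selectVoters.run s
    (∀ i < I.n, s'.arr aKeptV i = if v i then 1 else 0) ∧ s'.reg rKeptV = Nat.count v I.n := by
  intro s'
  have h₀ : Loaded I (firstRow.run s) := h.run _ (by decide)
  rw [← h₀.n]
  refine And.imp_right And.right (h₀.loop_induction (fun j s' =>
    (∀ i < j, s'.arr aKeptV i = if v i then 1 else 0) ∧
      s'.reg rRow = 6 + I.m + j * (I.m + 1) ∧ s'.reg rKeptV = Nat.count v j)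
    (by decide) (by decide) (by simp [firstRow, hK, h.m]) ?_)
  rintro j hj s' h' hs' hreg harr ⟨h1, h2, h3⟩
  rw [h₀.n] at hj
  set s₁ := (assign rC 0 ;; countRow).run s' with hs₁
  have hC : s₁.reg rC = Nat.count (fun a => p a ∧ I.Approves j a) I.m :=
    countRow_run (s := s'.setReg rC 0) (h'.run (assign rC 0) (by decide))
      (fun a ha => by rw [State.setReg_arr, harr aKeptA (by decide)]; exact hp a ha) hj
      (by simpa using h2) (by simp)
  have hfr : ∀ r ∉ (assign rC 0 ;; countRow).regs, s₁.reg r = s'.reg r := fun r => run_reg s'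
  have hI₁ := hfr rI (by decide)
  have hK₁ := hfr rKeptV (by decide)
  have hR₁ := hfr rRow (by decide)
  have hM₁ := hfr rM (by decide)
  have hV₁ : s₁.arr aKeptV = s'.arr aKeptV := run_arr s' (by decide)
  have hvj : 1 - (1 - s₁.reg rC) = if v j then 1 else 0 := by
    have : 0 < s₁.reg rC ↔ v j := by
      rw [hC, hv j hj, Nat.count_eq_card_filter_range, card_pos]
      simp [Finset.Nonempty]
    split_ifs with hvj
    · have := this.2 hvj; omega
    · have := mt this.1 hvj; omega
  rw [run_seq] at hs₁
  rw [run_seq, run_seq, ← hs₁]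
  refine ⟨fun i hi => ?_, ?_, ?_⟩
  · rcases Nat.lt_succ_iff_lt_or_eq.1 hi with hi | rfl
    · simp [nextRow, hI₁, hs', hi.ne, hV₁, h1 i hi]
    · simp [nextRow, hI₁, hs', hvj]
  · simp [nextRow, hR₁, hM₁, h2, h'.m]; ring
  · simp [nextRow, hI₁, hs', hvj, hK₁, h3, Nat.count_succ]

end Restrict

/-! ### Rounding the score bound -/

/-- Multiplication by repeated addition. The rounding error stays below the denominator of `S`, so
one carry per addition suffices. -/
theorem scale_run (h : Loaded I s) (hJ : s.reg rJ < I.m)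
    (hNum : s.reg rNum * I.scoreDen = I.scoreNum * s.reg rDen + s.reg rErr)
    (hErr : s.reg rErr < I.scoreDen) :
    let s' := scale.run s
    s'.reg rDen = (s.reg rJ + 1) * s.reg rDen ∧
      s'.reg rNum * I.scoreDen = I.scoreNum * s'.reg rDen + s'.reg rErr ∧
      s'.reg rErr < I.scoreDen := by
  intro s'
  set s₁ := (assign rNumAcc 0 ;; assign rDenAcc 0 ;; assign rErrAcc 0).run s with hs₁
  have h₁ : Loaded I s₁ := h.run _ (by decide)
  set P : Stmt := ite (reg rJ + 1 - reg rA)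
    (assign rNumAcc (reg rNumAcc + reg rNum) ;; assign rDenAcc (reg rDenAcc + reg rDen) ;;
      assign rErrAcc (reg rErrAcc + reg rErr) ;;
      ite (reg rErrAcc + 1 - reg rQ)
        (assign rErrAcc (reg rErrAcc - reg rQ) ;; assign rNumAcc (reg rNumAcc - 1)) skip) skip
    with hP
  have key : let s₂ := (loop rA rM P).run s₁
      s₂.reg rDenAcc = min (s.reg rJ + 1) I.m * s.reg rDen ∧
      s₂.reg rNumAcc * I.scoreDen = I.scoreNum * s₂.reg rDenAcc + s₂.reg rErrAcc ∧
      s₂.reg rErrAcc < I.scoreDen := by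
    rw [← h₁.m]
    refine h₁.loop_induction (fun j s₂ => s₂.reg rDenAcc = min (s.reg rJ + 1) j * s.reg rDen ∧
      s₂.reg rNumAcc * I.scoreDen = I.scoreNum * s₂.reg rDenAcc + s₂.reg rErrAcc ∧
      s₂.reg rErrAcc < I.scoreDen) (by decide) (by decide)
      (by simp [hs₁, I.scoreDen_pos]) ?_
    rintro j hj s₂ h₂ hs₂ hreg - ⟨h1, h2, h3⟩
    have hfr : ∀ r ∉ (assign rNumAcc 0 ;; assign rDenAcc 0 ;; assign rErrAcc 0).regs,
      s₁.reg r = s.reg r := fun r => run_reg s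
    have eJ := (hreg rJ (by decide) (by decide)).trans (hfr rJ (by decide))
    have eNum := (hreg rNum (by decide) (by decide)).trans (hfr rNum (by decide))
    have eDen := (hreg rDen (by decide) (by decide)).trans (hfr rDen (by decide))
    have eErr := (hreg rErr (by decide) (by decide)).trans (hfr rErr (by decide))
    by_cases hlt : s.reg rJ + 1 ≤ j
    · rw [min_eq_left hlt] at h1
      simp [hP, hs₂, eJ, Nat.sub_eq_zero_of_le hlt, min_eq_left (hlt.trans j.le_succ), h1, h2, h3]
    · have hne : s.reg rJ + 1 - j ≠ 0 := by omega
      rw [min_eq_right (by omega)] at h1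
      by_cases hge : s₂.reg rErrAcc + s.reg rErr < I.scoreDen
      · have hz : s₂.reg rErrAcc + s.reg rErr + 1 - I.scoreDen = 0 := by omega
        simp [hP, hs₂, eJ, hne, eNum, eDen, eErr, h₂.Q, hz, hge,
          min_eq_right (show j + 1 ≤ s.reg rJ + 1 by omega)]
        refine ⟨by rw [h1]; ring, ?_⟩
        linarith
      · have hz : s₂.reg rErrAcc + s.reg rErr + 1 - I.scoreDen ≠ 0 := by omega
        simp [hP, hs₂, eJ, hne, eNum, eDen, eErr, h₂.Q, hz,
          min_eq_right (show j + 1 ≤ s.reg rJ + 1 by omega)]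
        refine ⟨by rw [h1]; ring, ?_, by omega⟩
        -- The carry does not make the numerator negative.
        have hmul : (s₂.reg rNumAcc + s.reg rNum - 1) * I.scoreDen =
            s₂.reg rNumAcc * I.scoreDen + s.reg rNum * I.scoreDen - I.scoreDen := by
          rw [Nat.sub_mul, add_mul, one_mul]
        rw [hmul, h2, hNum, mul_add]
        omega
  have e : s' = (assign rNum (reg rNumAcc) ;; assign rDen (reg rDenAcc) ;;
    assign rErr (reg rErrAcc)).run ((loop rA rM P).run s₁) := rfl
  rw [min_eq_left (by omega)] at key
  rw [e]
  simpa using key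

/-- The numerator is `S * b!` rounded up, since the error `e` is less than the denominator of `S`. -/
theorem round_run (h : Loaded I s) {b : ℕ} (hB : s.reg rB = b) (hb : b ≤ I.m)
    (hSQ : s.reg rSQ = s.reg rS * I.scoreDen) (hge : I.scoreNum ≤ s.reg rSQ)
    (hlt : s.reg rSQ < I.scoreNum + I.scoreDen) :
    let s' := round.run s
    s'.reg rDen = b.factorial ∧ ∃ e < I.scoreDen,
      s'.reg rNum * I.scoreDen = I.scoreNum * s'.reg rDen + e := by
  intro s'
  suffices H : s'.reg rDen = (min b I.m).factorial ∧
      s'.reg rNum * I.scoreDen = I.scoreNum * s'.reg rDen + s'.reg rErr ∧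
      s'.reg rErr < I.scoreDen by
    rw [min_eq_left hb] at H
    exact ⟨H.1, _, H.2.2, H.2.1⟩
  set s₁ := (assign rNum (reg rS) ;; assign rDen 1 ;; assign rErr (reg rSQ - reg rP)).run s
    with hs₁
  have h₁ : Loaded I s₁ := h.run _ (by decide)
  rw [← h₁.m]
  refine h₁.loop_induction (fun j s' => s'.reg rDen = (min b j).factorial ∧
      s'.reg rNum * I.scoreDen = I.scoreNum * s'.reg rDen + s'.reg rErr ∧
      s'.reg rErr < I.scoreDen) (by decide) (by decide) ?_ ?_
  · simp [hs₁, h.P]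
    omega
  rintro j hj s₂ h₂ hs₂ hreg - ⟨h1, h2, h3⟩
  have eB : s₂.reg rB = b := by
    rw [hreg rB (by decide) (by decide), hs₁, run_reg _ (by decide), hB]
  by_cases hbj : b ≤ j
  · rw [min_eq_left hbj] at h1
    simp [eB, hs₂, Nat.sub_eq_zero_of_le hbj, min_eq_left (hbj.trans j.le_succ), h2, h3, h1]
  · have hne : b - j ≠ 0 := by omega
    obtain ⟨e1, e2, e3⟩ := scale_run h₂ (by rw [hs₂, ← h₁.m]; exact hj) h2 h3
    rw [min_eq_right (by omega)] at h1
    simp only [run_ite, eval_sub, eval_reg, eB, hs₂, hne, if_false, State.setReg_reg]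
    rw [min_eq_right (by omega), Nat.factorial_succ, ← h1, ← hs₂]
    exact ⟨e1, e2, e3⟩

/-! ### Writing the output -/

section Emit

variable {p v : ℕ → Prop} [DecidablePred p] [DecidablePred v]

theorem emitNames_run (h : Loaded I s) (hp : ∀ a < I.m, s.arr aKeptA a = if p a then 1 else 0) :
    (emitNames.run s).out = s.out ++ List.range (Nat.count p I.m) := by
  have h₀ : Loaded I ((assign rC 0).run s) := h.run _ (by decide)
  rw [← h₀.m]
  refine And.left (h₀.loop_induction (fun j s' => s'.out = s.out ++ List.range (Nat.count p j) ∧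
    s'.reg rC = Nat.count p j) (by decide) (by decide) (by simp) ?_)
  rintro j hj s' h' hs' - harr ⟨h1, h2⟩
  have hpj : s'.arr aKeptA j = if p j then 1 else 0 := by
    rw [harr _ (by decide)]; exact hp j (h₀.m ▸ hj)
  by_cases hj' : p j <;> simp [hs', hpj, hj', h1, h2, Nat.count_succ, List.range_succ]

theorem emitRow_run (h : Loaded I s) (hp : ∀ a < I.m, s.arr aKeptA a = if p a then 1 else 0)
    {i : ℕ} (hi : i < I.n) (hrow : s.reg rRow = 6 + I.m + i * (I.m + 1)) :
    (emitRow.run s).out = s.out ++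
      ((List.range I.m).filter p).map fun a => if I.Approves i a then 1 else 0 := by
  rw [← h.m]
  refine h.loop_induction (fun j s' => s'.out = s.out ++
      ((List.range j).filter p).map fun a => if I.Approves i a then 1 else 0)
    (by decide) (by decide) (by simp) ?_
  rintro j hj s' h' hs' hreg harr h1
  rw [h.m] at hj
  have hentry : entry.eval s' = if I.Approves i j then 1 else 0 := by
    simp [entry, hs', hreg rRow (by decide) (by decide), hrow, h'.row i hi j hj]
  have hpj : s'.arr aKeptA j = if p j then 1 else 0 := by rw [harr _ (by decide), hp j hj]
  by_cases hj' : p j <;> simp [hs', hpj, hj', hentry, h1, List.range_succ, List.filter_append]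

theorem emitMatrix_run (h : Loaded I s) (hp : ∀ a < I.m, s.arr aKeptA a = if p a then 1 else 0)
    (hv : ∀ i < I.n, s.arr aKeptV i = if v i then 1 else 0) :
    (emitMatrix.run s).out = s.out ++ (((List.range I.n).filter v).mapIdx fun t i =>
      t :: ((List.range I.m).filter p).map fun a => if I.Approves i a then 1 else 0).flatten := by
  have h₀ : Loaded I ((firstRow ;; assign rC 0).run s) := h.run _ (by decide)
  rw [← h₀.n]
  refine And.left (h₀.loop_induction (fun j s' =>
    s'.out = s.out ++ (((List.range j).filter v).mapIdx fun t i =>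
      t :: ((List.range I.m).filter p).map fun a => if I.Approves i a then 1 else 0).flatten ∧
    s'.reg rRow = 6 + I.m + j * (I.m + 1) ∧ s'.reg rC = ((List.range j).filter v).length)
    (by decide) (by decide) (by simp [firstRow, h.m]) ?_)
  rintro j hj s' h' hs' - harr ⟨h1, h2, h3⟩
  rw [h₀.n] at hj
  have hvj : s'.arr aKeptV j = if v j then 1 else 0 := by
    rw [harr _ (by decide)]; exact hv j hj
  have hnext : 6 + I.m + j * (I.m + 1) + (I.m + 1) = 6 + I.m + (j + 1) * (I.m + 1) := by ring
  by_cases hj' : v j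
  · set s₁ := (emit (reg rC) ;; assign rC (reg rC + 1)).run s' with hs₁
    have hout : (emitRow.run s₁).out = s₁.out ++ _ :=
      emitRow_run (h'.run _ (by decide)) (p := p) (fun a ha => by
        rw [run_arr _ (by decide), harr _ (by decide)]; exact hp a ha) hj
        ((run_reg _ (by decide)).trans h2)
    have hR : (emitRow.run s₁).reg rRow = s'.reg rRow := by
      rw [run_reg _ (by decide), hs₁, run_reg _ (by decide)]
    have hM : (emitRow.run s₁).reg rM = s'.reg rM := by
      rw [run_reg _ (by decide), hs₁, run_reg _ (by decide)]
    have hC : (emitRow.run s₁).reg rC = s'.reg rC + 1 := by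
      rw [run_reg _ (by decide), hs₁]; simp
    have e : (ite (cell aKeptV (reg rI)) (emit (reg rC) ;; assign rC (reg rC + 1) ;; emitRow)
        skip).run s' = emitRow.run s₁ := by
      simp [hs', hvj, hj', hs₁]
    rw [run_seq, e]
    refine ⟨?_, ?_, ?_⟩
    · simp only [nextRow, run_assign, State.setReg_out, hout]
      simp [hs₁, h1, h3, List.range_succ, List.filter_append, hj', List.mapIdx_append]
    · simp [nextRow, hR, hM, h2, h'.m, hnext]
    · simp [nextRow, hC, h3, List.range_succ, List.filter_append, hj']
  · simp [nextRow, hs', hvj, hj', h1, h2, h3, h'.m, hnext, List.range_succ, List.filter_append]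

end Emit

/-- The encoding of the restricted instance in terms of the original names. -/
theorem encode_restrict (I : PAVInstance) : I.restrict.encode =
    [I.kept.length, I.keptVoters.length, min I.k I.kept.length, ⌈I.S * I.b.factorial⌉₊,
      I.b.factorial] ++ List.range I.kept.length ++ (I.keptVoters.mapIdx fun t i =>
        t :: I.kept.map fun a => if I.Approves i a then 1 else 0).flatten := by
  have hrow : ∀ i : Fin I.keptVoters.length, ((List.finRange I.kept.length).map fun a =>
      if a ∈ I.restrict.approval i then 1 else 0) =
      I.kept.map fun a => if I.Approves (I.keptVoters.get i) a then 1 else 0 := fun i => by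
    conv_rhs => rw [← List.ofFn_get I.kept, List.ofFn_eq_map, List.map_map]
    refine List.map_congr_left fun a _ => ?_
    exact if_congr mem_approval_restrict rfl rfl
  rw [List.mapIdx_eq_ofFn, List.ofFn_eq_map, ← List.flatMap_def]
  refine congrArg₂ (· ++ ·) rfl (List.flatMap_congr fun i _ => ?_)
  exact congrArg (List.cons i.val) (hrow i)

theorem emitConst_run (c : Expr) (hc : ∀ s s' : State, c.eval s = c.eval s') :
    ((emitConst c).run s).out = s.out ++ (const (c.eval s)).encode := by
  simp only [emitConst, run_seq, run_emit, State.write_out, hc _ s, encode, const]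
  simp

theorem lt_S_iff {x : ℕ} : (x : ℚ) < I.S ↔ x * I.scoreDen < I.scoreNum := by
  rw [S, lt_div_iff₀ (by exact_mod_cast I.scoreDen_pos)]
  exact_mod_cast Iff.rfl

/-- A recognition criterion for ceilings of fractions with the denominator of `S`. -/
theorem ceil_eq_of_mul_eq {r : ℚ} {x c e : ℕ} (hr : r = x / I.scoreDen) (he : e < I.scoreDen)
    (h : c * I.scoreDen = x + e) : ⌈r⌉₊ = c := by
  have hQ : (0 : ℚ) < I.scoreDen := by exact_mod_cast I.scoreDen_pos
  have hq : (c : ℚ) * I.scoreDen = x + e := by exact_mod_cast h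
  have he' : (e : ℚ) < I.scoreDen := by exact_mod_cast he
  refine le_antisymm (Nat.ceil_le.2 ?_) (Nat.lt_succ_iff.1 ?_)
  · rw [hr, div_le_iff₀ hQ, hq]
    exact le_add_of_nonneg_right (Nat.cast_nonneg _)
  · have : (c : ℚ) < r + 1 := by
      rw [← mul_lt_mul_iff_left₀ hQ, hq, hr, add_mul, div_mul_cancel₀ _ hQ.ne']
      linarith
    exact_mod_cast this.trans_le (add_le_add_left (Nat.le_ceil r) 1)

theorem emitRestrict_run (h : Loaded I s) (hout : s.out = []) (hB : s.reg rB = I.b)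
    (hb : I.b ≤ I.m) (hSQ : s.reg rSQ = s.reg rS * I.scoreDen)
    (hge : I.scoreNum ≤ s.reg rSQ) (hlt : s.reg rSQ < I.scoreNum + I.scoreDen)
    (hp : ∀ a < I.m, s.arr aKeptA a = if I.rank a < 4 ^ I.param then 1 else 0)
    (hKA : s.reg rKeptA = Nat.count (I.rank · < 4 ^ I.param) I.m) (hKV : s.reg rKeptV = 0) :
    (emitRestrict.run s).out = I.restrict.encode := by
  set s₁ := selectVoters.run s with hs₁
  set s₂ := round.run s₁ with hs₂
  have h₁ : Loaded I s₁ := h.run _ (by decide)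
  have h₂ : Loaded I s₂ := h₁.run _ (by decide)
  obtain ⟨hv₁, hKV₁⟩ := selectVoters_run h hp hKV (v := fun i => ∃ a ∈ I.kept, I.Approves i a)
    fun i _ => by simp [kept, and_assoc]
  have hfr : ∀ r ∉ selectVoters.regs, s₁.reg r = s.reg r := fun r => run_reg s
  obtain ⟨hDen, e, he, hNum⟩ := round_run (s := s₁) h₁ ((hfr rB (by decide)).trans hB) hb
    (by rw [hfr rSQ (by decide), hfr rS (by decide), hSQ])
    (by rwa [hfr rSQ (by decide)]) (by rwa [hfr rSQ (by decide)])
  have hQ : (I.scoreDen : ℚ) ≠ 0 := by exact_mod_cast I.scoreDen_pos.ne'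
  have hceil : ⌈I.S * I.b.factorial⌉₊ = s₂.reg rNum :=
    ceil_eq_of_mul_eq (x := I.scoreNum * I.b.factorial)
      (by rw [S]; push_cast; field_simp) he (by rw [hNum, hDen])
  have hlenA : I.kept.length = Nat.count (I.rank · < 4 ^ I.param) I.m := by
    rw [kept, Nat.count, List.countP_eq_length_filter]
  have hlenV : I.keptVoters.length = Nat.count (fun i => ∃ a ∈ I.kept, I.Approves i a) I.n := by
    rw [keptVoters, Nat.count, List.countP_eq_length_filter]
  have eA : s₂.reg rKeptA = I.kept.length := by
    rw [hs₂, run_reg _ (by decide), hfr _ (by decide), hKA, hlenA]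
  have eV : s₂.reg rKeptV = I.keptVoters.length := by
    rw [hs₂, run_reg _ (by decide), hKV₁, hlenV]
  have hout₂ : s₂.out = [] := by rw [hs₂, run_out _ (by decide), hs₁, run_out _ (by decide), hout]
  have harr : ∀ P : Stmt, aKeptA ∉ P.arrs → ∀ s', s'.arr = s₂.arr →
      ∀ a < I.m, (P.run s').arr aKeptA a = if I.rank a < 4 ^ I.param then 1 else 0 :=
    fun P hP s' hs' a ha => by
      rw [run_arr _ hP, hs', hs₂, run_arr _ (by decide), hs₁, run_arr _ (by decide), hp a ha]
  set s₃ := (emit (reg rKeptA) ;; emit (reg rKeptV) ;; emit (reg rK - (reg rK - reg rKeptA)) ;;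
    emit (reg rNum) ;; emit (reg rDen)).run s₂ with hs₃
  have h₃ : Loaded I s₃ := h₂.run _ (by decide)
  have hout₃ : s₃.out = [I.kept.length, I.keptVoters.length, min I.k I.kept.length,
      ⌈I.S * I.b.factorial⌉₊, I.b.factorial] := by
    simp [hs₃, hout₂, eA, eV, h₂.k, hceil, show s₂.reg rDen = _ from hDen]
    omega
  have e : (emitRestrict.run s).out = (emitMatrix.run (emitNames.run s₃)).out := rfl
  rw [e, encode_restrict, emitMatrix_run (h₃.run _ (by decide))
    (p := (I.rank · < 4 ^ I.param)) (v := fun i => ∃ a ∈ I.kept, I.Approves i a)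
    (harr emitNames (by decide) s₃ rfl) (fun i hi => by
      rw [run_arr _ (by decide), hs₃, run_arr _ (by decide), hs₂, run_arr _ (by decide), hv₁ i hi]),
    emitNames_run h₃ (p := (I.rank · < 4 ^ I.param)) (harr skip (by decide) s₃ rfl), hout₃, ← hlenA]
  rfl

/-- The program writes the encoding of the kernel. -/
theorem kernelStmt_run (h : Loaded I s) (hreg : ∀ r, 5 < r → s.reg r = 0)
    (harr : ∀ a, s.arr aDeg a = 0) (hout : s.out = []) :
    (kernelStmt.run s).out = I.kernel.encode := by
  set s₁ := tally.run s with hs₁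
  set s₂ := ceiling.run s₁ with hs₂
  set s₃ := selectAlternatives.run s₂ with hs₃
  have h₁ : Loaded I s₁ := h.run _ (by decide)
  have h₂ : Loaded I s₂ := h₁.run _ (by decide)
  have h₃ : Loaded I s₃ := h₂.run _ (by decide)
  have hfr₁ : ∀ r ∉ tally.regs, s₁.reg r = s.reg r := fun r => run_reg s
  have hfr₂ : ∀ r ∉ ceiling.regs, s₂.reg r = s₁.reg r := fun r => run_reg s₁
  have hfr₃ : ∀ r ∉ selectAlternatives.regs, s₃.reg r = s₂.reg r := fun r => run_reg s₂
  have hb : I.b ≤ I.m := Finset.sup_le fun i _ => by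
    simpa using card_le_univ (I.approval i)
  obtain ⟨hB, hdeg⟩ := tally_run h (hreg rB (by decide)) harr
  obtain ⟨hSQ, hlt, hle, hcap, hT⟩ := ceiling_run h₁
    ((hfr₁ rSQ (by decide)).trans (hreg _ (by decide)))
    ((hfr₁ rS (by decide)).trans (hreg _ (by decide))) hB hb
  rw [← hs₂] at hSQ hlt hle hcap hT
  have hzero : ∀ r, 5 < r → r ∉ tally.regs → r ∉ ceiling.regs → s₂.reg r = 0 :=
    fun r h5 hr₁ hr₂ => by rw [hfr₂ r hr₂, hfr₁ r hr₁, hreg r h5]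
  obtain ⟨hp, hKA, hH⟩ := selectAlternatives_run (s := s₂) h₂
    (fun a ha => by rw [hs₂, run_arr _ (by decide)]; exact hdeg a ha)
    (hzero _ (by decide) (by decide) (by decide)) (hzero _ (by decide) (by decide) (by decide))
  rw [← hs₃] at hp hKA hH
  have eS := hfr₃ rS (by decide)
  have eSQ := hfr₃ rSQ (by decide)
  have eB : s₃.reg rB = I.b := by rw [hfr₃ rB (by decide), hfr₂ rB (by decide), hB]
  have hout₃ : s₃.out = [] := by
    rw [hs₃, run_out _ (by decide), hs₂, run_out _ (by decide), hs₁, run_out _ (by decide), hout]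
  have e1 : ((emitConst 1).run s₃).out = (const 1).encode := by
    rw [emitConst_run 1 fun _ _ => rfl, hout₃]; rfl
  have e0 : ((emitConst 0).run s₃).out = (const 0).encode := by
    rw [emitConst_run 0 fun _ _ => rfl, hout₃]; rfl
  have e : kernelStmt.run s = emitKernel.run s₃ := rfl
  rw [e, emitKernel, kernel]
  simp only [run_ite, eval_sub, eval_reg, h₃.k, h₃.m, h₃.P, eSQ, Nat.sub_eq_zero_iff_le]
  by_cases hk : I.m < I.k
  · rw [if_neg hk.not_ge, if_pos hk, e1]
  rw [if_pos (not_lt.1 hk), if_neg hk]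
  by_cases hP : I.scoreNum = 0
  · rw [if_pos hP, if_pos hP, e0]
  rw [if_neg hP, if_neg hP]
  by_cases hk0 : I.k = 0
  · rw [if_pos hk0, if_pos hk0, e1]
  rw [if_neg hk0, if_neg hk0]
  by_cases hbig : I.scoreNum ≤ s₂.reg rSQ
  · have hS : s₂.reg rS = ⌈I.S⌉₊ := (ceil_eq_of_mul_eq (e := s₂.reg rSQ - I.scoreNum) rfl
      (by omega) (by rw [← hSQ]; omega)).symm
    have hnm : ¬ ((I.n * I.m : ℕ) : ℚ) < I.S := by
      rw [lt_S_iff, not_lt]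
      exact hbig.trans (hSQ.trans_le (Nat.mul_le_mul_right _ hle))
    rw [if_pos hbig, if_neg hnm]
    have hT' : s₂.reg rT = 4 ^ I.param := by rw [hT, hS]; rfl
    rw [hT'] at hp hKA
    have hHigh : s₃.reg rHigh = 0 ↔ ¬ ∃ a < I.m, ⌈I.S⌉₊ ≤ I.degree a := by
      rw [hH, hS, Nat.count_eq_card_filter_range, card_eq_zero, filter_eq_empty_iff]
      simp
    by_cases hd : ∃ a < I.m, ⌈I.S⌉₊ ≤ I.degree a
    · rw [if_pos hd]
      exact (congrArg State.out (if_neg fun h => hHigh.1 h hd)).trans e0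
    · rw [if_neg hd]
      refine (congrArg State.out (if_pos (hHigh.2 hd))).trans ?_
      exact emitRestrict_run h₃ hout₃ eB hb (by rw [eSQ, eS, hSQ])
        (by rwa [eSQ]) (by rwa [eSQ]) hp hKA
        ((hfr₃ _ (by decide)).trans (hzero _ (by decide) (by decide) (by decide)))
  · have hnm : ((I.n * I.m : ℕ) : ℚ) < I.S := by
      rw [lt_S_iff, ← hcap (not_le.1 hbig), ← hSQ]
      exact not_le.1 hbig
    rw [if_neg hbig, if_pos hnm, e1]

theorem length_le_wordSize (w : List ℕ) : w.length ≤ wordSize w := by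
  induction w with
  | nil => simp
  | cons x w ih => simp only [wordSize, List.map_cons, List.sum_cons, List.length_cons] at *; omega

theorem polyTimeComputable_kernel : PolyTimeComputable encode kernel := by
  refine polyTimeComputable_of_run [rM, rN] load kernelStmt (by decide) (by decide)
    (fun I => ?_) (fun I => ?_)
  · have h := loaded_load I
    have hlen := length_le_wordSize I.encode
    rw [length_encode] at hlen
    have : I.n ≤ I.n * (I.m + 1) := Nat.le_mul_of_pos_right _ I.m.succ_pos
    simp only [List.forall_mem_cons, List.not_mem_nil, false_implies, implies_true, and_true,
      h.m, h.n]
    omega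
  · refine kernelStmt_run (loaded_load I) (fun r hr => ?_) (fun a => ?_) ?_
    · have : r ∉ load.regs := by
        simp only [load, regs, List.mem_append, List.mem_singleton]
        omega
      rw [run_reg _ this]
      exact if_neg (by omega)
    · rw [run_arr _ (by decide)]
      rfl
    · rw [run_out _ (by decide)]
      rfl

end PAVInstance

/-- PAV multi-winner determination admits a kernel, of exponential size, for the combined parameter
maximum approval-set size `b` and score bound `S`. -/
theorem mainTheorem1 :
    ∃ q : Polynomial ℕ,
      AdmitsKernelOfSize PAVInstance.encode PAVInstance.IsYes PAVInstance.param
        (fun κ => 2 ^ q.eval κ) := by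
  refine ⟨3 * (.X ^ 2 + 3 * .X) + 4, PAVInstance.kernel, PAVInstance.polyTimeComputable_kernel,
    fun I => ⟨PAVInstance.isYes_kernel, ?_⟩⟩
  simpa using PAVInstance.kernel_size I
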